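/- Let $n\in\mathbb N$, let $a<b$ be real, and set $\mathcal J=\begin{pmatrix}0&I\\-I&0\end{pmatrix}\in\mathbb R^{2n\times 2n}$, $E=\begin{pmatrix}0\\I\end{pmatrix}\in\mathbb R^{2n\times n}$. A \emph{Lagrangian plane} is a matrix $C\in\mathbb R^{2n\times n}$ with $C^T\mathcal JC=0$ and $\operatorname{rank}C=n$; a continuous function $Y:[a,b]\to\mathbb R^{2n\times n}$ whose values are Lagrangian planes is a \emph{continuous Lagrangian path}. A matrix $S\in\mathbb R^{2n\times 2n}$ is symplectic if $S^T\mathcal JS=\mathcal J$. Write $Y=\begin{pmatrix}X\\U\end{pmatrix}$ with $n\times n$ blocks $X,U$, and $W(Y,\hat Y)=Y^T\mathcal J\hat Y$. For Lagrangian planes $Y,\hat Y$ (with upper blocks $X,\hat X$) put $$\mathcal M=(I-X^\dagger X)\,W(Y,\hat Y),\quad V=I-\mathcal M^\dagger\mathcal M,\quad \mathcal P=V\,W(Y,\hat Y)^TX^\dagger\hat X\,V,$$ where $\dagger$ is the Moore--Penrose pseudoinverse. The comparative index and the dual comparative index are $\mu(Y,\hat Y)=\operatorname{rank}\mathcal M+\operatorname{ind}\mathcal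 P$ and $\mu^*(Y,\hat Y)=\operatorname{rank}\mathcal M+\operatorname{ind}(-\mathcal P)$, where $\operatorname{ind}$ is the number of negative eigenvalues (with multiplicity) of a symmetric matrix. For a continuous Lagrangian path $Y$ on $[a,b]$ take a partition $a=t_0<t_1<\dots<t_p=b$ and symplectic matrix functions $R_0,\dots,R_{p-1}$ on $[a,b]$, with $R_k$ continuous on $[t_k,t_{k+1}]$, such that $\operatorname{rank}W(R_k(t)E,Y(t))$ and the rank of the upper block of $R_k(t)E$ are constant on $[t_k,t_{k+1}]$ for every $k$. The oscillation number and the dual oscillation number of $Y$ on $[a,b]$ are $$\mathcal N(Y)=\sum_{k=0}^{p-1}\Big(\mu\big(Y(t_{k+1}),R_k(t_{k+1})E\big)-\mu\big(Y(t_k),R_k(t_k)E\big)\Big),$$ $$\mathcal N^*(Y)=\sum_{k=0}^{p-1}\Big(\mu^*\big(Y(t_k),R_k(t_k)E\big)-\mu^*\big(Y(t_{k+1}),R_k(t_{k+1})E\big)\Big);$$ such partitions and systems $(R_k)$ exist, and these values do not depend on their choice. \textbf{Theorem.} Let $\Phi:[a,b]\to\mathbb R^{2n\times2n}$ be continuous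 with symplectic values and let $\mathcal F(\Phi)=\{\Phi(\cdot)C : C \text{ a Lagrangian plane}\}$. Let $Y_a,Y_b\in\mathcal F(\Phi)$ be the (unique) members with $Y_a(a)=E=Y_b(b)$. Then the numbers $\mathcal N(Y),\mathcal N^*(Y)$ of all $Y\in\mathcal F(\Phi)$ are well defined, and for any integers $\ell,r$ with $$\mathcal N(Y_a)\le\ell\le\mathcal N(Y_b)\quad\text{and}\quad\mathcal N^*(Y_b)\le r\le\mathcal N^*(Y_a)$$ there exists $Y\in\mathcal F(\Phi)$ with $\mathcal N(Y)=\ell$ and $\mathcal N^*(Y)=r$. Moreover, if $\ell\ge r$, then such a $Y$ can be chosen with $X(a)=I$; if $\ell\le r$, then such a $Y$ can be chosen with $X(b)=I$; and if $\ell=r$, then such a $Y$ can be chosen with both $X(a)$ and $X(b)$ invertible. -/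

import Mathlib

open Matrix Set

/-- The canonical skew-symmetric matrix `J = [0 I; -I 0]` of size `2n × 2n`. -/
def skewJ (n : ℕ) : Matrix (Fin n ⊕ Fin n) (Fin n ⊕ Fin n) ℝ :=
  Matrix.fromBlocks 0 1 (-1) 0

/-- The vertical Lagrangian plane `E = (0 I)ᵀ`. -/
def vertE (n : ℕ) : Matrix (Fin n ⊕ Fin n) (Fin n) ℝ :=
  Matrix.fromRows 0 1

/-- Mathlib's symplectic group is the set of all `S` with `Sᵀ J S = J`. -/
theorem mem_symplecticGroup_iff_skewJ {n : ℕ} (S : Matrix (Fin n ⊕ Fin n) (Fin n ⊕ Fin n) ℝ) :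
    S ∈ Matrix.symplecticGroup (Fin n) ℝ ↔ Sᵀ * skewJ n * S = skewJ n := by
  have h : Matrix.J (Fin n) ℝ = -skewJ n := by
    simp [Matrix.J, skewJ, Matrix.fromBlocks_neg]
  rw [SymplecticGroup.mem_iff', h]
  simp

/-- A Lagrangian plane: a `2n × n` matrix `C` with `Cᵀ J C = 0` and `rank C = n`. -/
def IsLagrangianPlane {n : ℕ} (C : Matrix (Fin n ⊕ Fin n) (Fin n) ℝ) : Prop :=
  Cᵀ * skewJ n * C = 0 ∧ C.rank = n

/-- The Wronskian `W(Y, Y') = Yᵀ J Y'`. -/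
def wronskian {n : ℕ} (Y Y' : Matrix (Fin n ⊕ Fin n) (Fin n) ℝ) : Matrix (Fin n) (Fin n) ℝ :=
  Yᵀ * skewJ n * Y'

/-- The four Penrose equations: `B` is the Moore–Penrose pseudoinverse of the real matrix `A`. -/
structure IsMoorePenrose {n : ℕ} (A B : Matrix (Fin n) (Fin n) ℝ) : Prop where
  mul_mul_left : A * B * A = A
  mul_mul_right : B * A * B = B
  symm_left : (A * B)ᵀ = A * B
  symm_right : (B * A)ᵀ = B * A

theorem exists_symm_inner_inverse {n : ℕ} (H : Matrix (Fin n) (Fin n) ℝ) (hH : H.IsHermitian) :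
    ∃ G : Matrix (Fin n) (Fin n) ℝ, Gᵀ = G ∧ (G * H)ᵀ = G * H ∧ H * G * H = H ∧
      G * H * G = G := by
  set U : Matrix (Fin n) (Fin n) ℝ := (hH.eigenvectorUnitary : Matrix (Fin n) (Fin n) ℝ) with hU
  set d : Fin n → ℝ := hH.eigenvalues with hd
  have hUU : Uᵀ * U = 1 := by
    have h := Unitary.coe_star_mul_self hH.eigenvectorUnitary
    simpa [Matrix.star_eq_conjTranspose, Matrix.conjTranspose_eq_transpose_of_trivial] using h
  have hs : H = U * diagonal d * Uᵀ := by
    have h := hH.spectral_theorem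
    rw [Unitary.conjStarAlgAut_apply] at h
    simpa [Matrix.star_eq_conjTranspose, Matrix.conjTranspose_eq_transpose_of_trivial,
      Function.comp_def] using h
  have key : ∀ x y : Fin n → ℝ, (U * diagonal x * Uᵀ) * (U * diagonal y * Uᵀ)
      = U * diagonal (fun i => x i * y i) * Uᵀ := by
    intro x y
    calc (U * diagonal x * Uᵀ) * (U * diagonal y * Uᵀ)
        = U * diagonal x * (Uᵀ * U) * diagonal y * Uᵀ := by simp only [Matrix.mul_assoc]
      _ = _ := by rw [hUU, Matrix.mul_one, Matrix.mul_assoc U, diagonal_mul_diagonal]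
  have hT : ∀ x : Fin n → ℝ, (U * diagonal x * Uᵀ)ᵀ = U * diagonal x * Uᵀ := by
    intro x
    simp [Matrix.transpose_mul, Matrix.mul_assoc]
  refine ⟨U * diagonal (fun i => (d i)⁻¹) * Uᵀ, hT _, ?_, ?_, ?_⟩
  · rw [hs, key, hT]
  · rw [hs, key, key]; simp
  · rw [hs, key, key]
    congr 3
    funext i
    by_cases h : d i = 0 <;> simp [h]

/-- Every real square matrix has exactly one Moore–Penrose pseudoinverse. -/
theorem existsUnique_moorePenrose {n : ℕ} (A : Matrix (Fin n) (Fin n) ℝ) :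
    ∃! B, IsMoorePenrose A B := by
  refine existsUnique_of_exists_of_unique ?_ ?_
  · have hH : (Aᵀ * A).IsHermitian := by
      simpa [Matrix.conjTranspose_eq_transpose_of_trivial] using isHermitian_conjTranspose_mul_self A
    obtain ⟨G, h1, h2, h3, h4⟩ := exists_symm_inner_inverse _ hH
    refine ⟨G * Aᵀ, ⟨?_, ?_, ?_, ?_⟩⟩
    · have h : Aᵀ * A * (G * (Aᵀ * A) - 1) = 0 := by
        rw [Matrix.mul_sub, ← Matrix.mul_assoc, h3, Matrix.mul_one, sub_self]
      have h' : A * (G * (Aᵀ * A) - 1) = 0 := by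
        have := (conjTranspose_mul_self_mul_eq_zero A (G * (Aᵀ * A) - 1)).1
        rw [Matrix.conjTranspose_eq_transpose_of_trivial] at this
        exact this h
      rw [Matrix.mul_sub, Matrix.mul_one, sub_eq_zero] at h'
      simpa only [Matrix.mul_assoc] using h'
    · calc G * Aᵀ * A * (G * Aᵀ) = (G * (Aᵀ * A) * G) * Aᵀ := by simp only [Matrix.mul_assoc]
        _ = _ := by rw [h4]
    · simp [Matrix.transpose_mul, h1, Matrix.mul_assoc]
    · simpa only [Matrix.mul_assoc] using h2
  · intro B C hB hC
    have e1 : A * B = A * C := by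
      calc A * B = (A * C * A) * B := by rw [hC.mul_mul_left]
        _ = (A * C)ᵀ * (A * B)ᵀ := by rw [hC.symm_left, hB.symm_left]; simp only [Matrix.mul_assoc]
        _ = ((A * B * A) * C)ᵀ := by rw [← Matrix.transpose_mul]; simp only [Matrix.mul_assoc]
        _ = A * C := by rw [hB.mul_mul_left, hC.symm_left]
    have e2 : B * A = C * A := by
      calc B * A = B * (A * C * A) := by rw [hC.mul_mul_left]
        _ = (B * A)ᵀ * (C * A)ᵀ := by
          rw [hB.symm_right, hC.symm_right]; simp only [Matrix.mul_assoc]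
        _ = (C * (A * B * A))ᵀ := by rw [← Matrix.transpose_mul]; simp only [Matrix.mul_assoc]
        _ = C * A := by rw [hB.mul_mul_left, hC.symm_right]
    calc B = B * A * B := hB.mul_mul_right.symm
      _ = C * (A * B) := by rw [e2, Matrix.mul_assoc]
      _ = C := by rw [e1, ← Matrix.mul_assoc, hC.mul_mul_right]

/-- The Moore–Penrose pseudoinverse `A†`. -/
noncomputable def pinv {n : ℕ} (A : Matrix (Fin n) (Fin n) ℝ) : Matrix (Fin n) (Fin n) ℝ :=
  (existsUnique_moorePenrose A).choose

theorem pinv_spec {n : ℕ} (A : Matrix (Fin n) (Fin n) ℝ) : IsMoorePenrose A (pinv A) :=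
  (existsUnique_moorePenrose A).choose_spec.1

/-- The index of a symmetric matrix: the number of its negative eigenvalues, counted with
multiplicity (as roots of the characteristic polynomial). -/
noncomputable def negIndex {n : ℕ} (P : Matrix (Fin n) (Fin n) ℝ) : ℕ :=
  P.charpoly.roots.countP (fun x => x < 0)

/-- The matrix `M = (I - X† X) W(Y, Y')` where `X` is the upper block of `Y`. -/
noncomputable def compM {n : ℕ} (Y Y' : Matrix (Fin n ⊕ Fin n) (Fin n) ℝ) :
    Matrix (Fin n) (Fin n) ℝ :=
  (1 - pinv Y.toRows₁ * Y.toRows₁) * wronskian Y Y'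

/-- The orthogonal projector `V = I - M† M`. -/
noncomputable def compV {n : ℕ} (Y Y' : Matrix (Fin n ⊕ Fin n) (Fin n) ℝ) :
    Matrix (Fin n) (Fin n) ℝ :=
  1 - pinv (compM Y Y') * compM Y Y'

/-- The symmetric matrix `P = V W(Y, Y')ᵀ X† X' V`, where `X`, `X'` are the upper blocks. -/
noncomputable def compP {n : ℕ} (Y Y' : Matrix (Fin n ⊕ Fin n) (Fin n) ℝ) :
    Matrix (Fin n) (Fin n) ℝ :=
  compV Y Y' * (wronskian Y Y')ᵀ * pinv Y.toRows₁ * Y'.toRows₁ * compV Y Y'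

/-- The comparative index `μ(Y, Y') = rank M + ind P`. -/
noncomputable def compIndex {n : ℕ} (Y Y' : Matrix (Fin n ⊕ Fin n) (Fin n) ℝ) : ℕ :=
  (compM Y Y').rank + negIndex (compP Y Y')

/-- The dual comparative index `μ*(Y, Y') = rank M + ind (-P)`. -/
noncomputable def dualCompIndex {n : ℕ} (Y Y' : Matrix (Fin n ⊕ Fin n) (Fin n) ℝ) : ℕ :=
  (compM Y Y').rank + negIndex (-compP Y Y')

/-- A partition `a = t 0 < t 1 < ⋯ < t p = b` and symplectic matrix functions
`R 0, …, R (p - 1)` on `[a, b]`, with `R k` continuous on `[t k, t (k + 1)]`, such that on each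
`[t k, t (k + 1)]` the Wronskian `W(R k s E, Y s)` (which is, up to the sign, the upper block of
`(R k s)⁻¹ Y s`) and the upper block of `R k s E` have constant rank.  The values of `t` beyond `p`
and of `R` at and beyond `p` play no role. -/
structure IsAdmissible {n : ℕ} (a b : ℝ) (Y : ℝ → Matrix (Fin n ⊕ Fin n) (Fin n) ℝ) (p : ℕ)
    (t : ℕ → ℝ) (R : ℕ → ℝ → Matrix (Fin n ⊕ Fin n) (Fin n ⊕ Fin n) ℝ) : Prop where
  first : t 0 = a
  last : t p = b
  lt_succ : ∀ k < p, t k < t (k + 1)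
  symplectic : ∀ k < p, ∀ s ∈ Icc a b, R k s ∈ Matrix.symplecticGroup (Fin n) ℝ
  continuousOn : ∀ k < p, ContinuousOn (R k) (Icc (t k) (t (k + 1)))
  rank_wronskian : ∀ k < p, ∃ ρ : ℕ, ∀ s ∈ Icc (t k) (t (k + 1)),
    (wronskian (R k s * vertE n) (Y s)).rank = ρ
  rank_upper : ∀ k < p, ∃ ρ : ℕ, ∀ s ∈ Icc (t k) (t (k + 1)),
    (R k s * vertE n).toRows₁.rank = ρ

/-- `N(Y, D, R)`, the sum over `k < p` of `μ(Y(s), R k s E)` taken from `s = t k` to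
`s = t (k + 1)`. -/
noncomputable def oscSum {n : ℕ} (Y : ℝ → Matrix (Fin n ⊕ Fin n) (Fin n) ℝ) (p : ℕ)
    (t : ℕ → ℝ) (R : ℕ → ℝ → Matrix (Fin n ⊕ Fin n) (Fin n ⊕ Fin n) ℝ) : ℤ :=
  ∑ k ∈ Finset.range p,
    ((compIndex (Y (t (k + 1))) (R k (t (k + 1)) * vertE n) : ℤ)
      - (compIndex (Y (t k)) (R k (t k) * vertE n) : ℤ))

/-- `N*(Y, D, R)`, the sum over `k < p` of `μ*(Y(s), R k s E)` taken from `s = t (k + 1)` to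
`s = t k`. -/
noncomputable def dualOscSum {n : ℕ} (Y : ℝ → Matrix (Fin n ⊕ Fin n) (Fin n) ℝ) (p : ℕ)
    (t : ℕ → ℝ) (R : ℕ → ℝ → Matrix (Fin n ⊕ Fin n) (Fin n ⊕ Fin n) ℝ) : ℤ :=
  ∑ k ∈ Finset.range p,
    ((dualCompIndex (Y (t k)) (R k (t k) * vertE n) : ℤ)
      - (dualCompIndex (Y (t (k + 1))) (R k (t (k + 1)) * vertE n) : ℤ))

/-- `N` is the well-defined oscillation number of `Y` on `[a, b]`: admissible partitions and
systems exist, and `N(Y, D, R) = N` for all of them. -/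
def IsOscNumber {n : ℕ} (a b : ℝ) (Y : ℝ → Matrix (Fin n ⊕ Fin n) (Fin n) ℝ) (N : ℤ) : Prop :=
  (∃ p t R, IsAdmissible a b Y p t R) ∧ ∀ p t R, IsAdmissible a b Y p t R → oscSum Y p t R = N

/-- `N` is the well-defined dual oscillation number of `Y` on `[a, b]`: admissible partitions and
systems exist, and `N*(Y, D, R) = N` for all of them. -/
def IsDualOscNumber {n : ℕ} (a b : ℝ) (Y : ℝ → Matrix (Fin n ⊕ Fin n) (Fin n) ℝ) (N : ℤ) : Prop :=
  (∃ p t R, IsAdmissible a b Y p t R) ∧ ∀ p t R, IsAdmissible a b Y p t R → dualOscSum Y p t R = N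

/-- The oscillation number `N(Y)` of `Y` on `[a, b]`: the only integer with `IsOscNumber`. -/
noncomputable def oscNumber {n : ℕ} (a b : ℝ) (Y : ℝ → Matrix (Fin n ⊕ Fin n) (Fin n) ℝ) : ℤ :=
  Classical.epsilon (IsOscNumber a b Y)

/-- The dual oscillation number `N*(Y)` of `Y` on `[a, b]`: the only integer with
`IsDualOscNumber`. -/
noncomputable def dualOscNumber {n : ℕ} (a b : ℝ)
    (Y : ℝ → Matrix (Fin n ⊕ Fin n) (Fin n) ℝ) : ℤ :=
  Classical.epsilon (IsDualOscNumber a b Y)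

/-- The set `F(Φ)` of all Lagrangian paths `Y = Φ C` on `[a, b]` with a Lagrangian plane `C`. -/
def lagrangianFamily {n : ℕ} (a b : ℝ) (Φ : ℝ → Matrix (Fin n ⊕ Fin n) (Fin n ⊕ Fin n) ℝ) :
    Set (ℝ → Matrix (Fin n ⊕ Fin n) (Fin n) ℝ) :=
  {Y | ∃ C, IsLagrangianPlane C ∧ ∀ s ∈ Icc a b, Y s = Φ s * C}

open Polynomial in
/-- The number of negative real roots of the characteristic polynomial, with multiplicity. -/
noncomputable def idx {ι : Type*} [Fintype ι] [DecidableEq ι] (A : Matrix ι ι ℝ) : ℕ :=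
  A.charpoly.roots.countP (fun x => x < 0)

theorem negIndex_eq_idx {n : ℕ} (P : Matrix (Fin n) (Fin n) ℝ) : negIndex P = idx P := rfl

/-! ### Inertia of real symmetric matrices. -/

section Index

variable {ι κ : Type*} [Fintype ι] [DecidableEq ι] [Fintype κ] [DecidableEq κ]

-- If `Q R = 0`, then `(x - Q)(x - R) = x (x - Q - R)`; take determinants.
open Polynomial in
theorem charpoly_mul_charpoly_of_mul_eq_zero (Q R : Matrix ι ι ℝ) (h : Q * R = 0) :
    Q.charpoly * R.charpoly = X ^ Fintype.card ι * (Q + R).charpoly := by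
  have key : charmatrix Q * charmatrix R = (X : ℝ[X]) • charmatrix (Q + R) := by
    have h' : (C : ℝ →+* ℝ[X]).mapMatrix Q * (C : ℝ →+* ℝ[X]).mapMatrix R = 0 := by
      rw [← map_mul, h, map_zero]
    simp only [charmatrix, Matrix.sub_mul, Matrix.mul_sub, h', map_add]
    simp only [scalar_apply, ← smul_one_eq_diagonal, Matrix.smul_mul, Matrix.mul_smul,
      Matrix.one_mul, Matrix.mul_one, smul_sub, smul_add]
    abel
  rw [Matrix.charpoly, Matrix.charpoly, ← det_mul, key, det_smul, Matrix.charpoly]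

theorem idx_add_of_mul_eq_zero (Q R : Matrix ι ι ℝ) (h : Q * R = 0) :
    idx (Q + R) = idx Q + idx R := by
  have hk := congrArg Polynomial.roots (charpoly_mul_charpoly_of_mul_eq_zero Q R h)
  rw [Polynomial.roots_mul ((charpoly_monic Q).mul (charpoly_monic R)).ne_zero,
    Polynomial.roots_mul ((Polynomial.monic_X_pow _).mul (charpoly_monic _)).ne_zero,
    Polynomial.roots_X_pow] at hk
  have := congrArg (Multiset.countP (fun x : ℝ => x < 0)) hk
  rw [Multiset.countP_add, Multiset.countP_add, Multiset.countP_nsmul] at this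
  simp only [idx]
  rw [this]
  have h0 : Multiset.countP (fun x : ℝ => x < 0) {0} = 0 := by
    rw [Multiset.countP_eq_zero]
    simp
  rw [h0, mul_zero, zero_add]

theorem idx_fromBlocks_zero (A : Matrix ι ι ℝ) (D : Matrix κ κ ℝ) :
    idx (fromBlocks A 0 0 D) = idx A + idx D := by
  simp only [idx]
  rw [charpoly_fromBlocks_zero₁₂,
    Polynomial.roots_mul ((charpoly_monic _).mul (charpoly_monic _)).ne_zero, Multiset.countP_add]

theorem idx_diagonal (d : ι → ℝ) : idx (diagonal d) = {i | d i < 0}.ncard := by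
  rw [idx, charpoly_diagonal, Polynomial.roots_prod _ _ (by
    simp [Finset.prod_ne_zero_iff, Polynomial.X_sub_C_ne_zero])]
  simp [Multiset.countP_map, Set.ncard_eq_toFinset_card', Finset.card_def, Finset.filter_val]

theorem toQuadraticForm'_apply (A : Matrix ι ι ℝ) (x : ι → ℝ) :
    A.toQuadraticForm' x = x ⬝ᵥ A *ᵥ x := by
  simp [Matrix.toQuadraticForm', Matrix.toLinearMap₂'_apply']

theorem equivalent_of_congr (A G : Matrix ι ι ℝ) (hG : IsUnit G.det) :
    QuadraticMap.Equivalent (Gᵀ * A * G).toQuadraticForm' A.toQuadraticForm' := by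
  have : Invertible G := G.invertibleOfIsUnitDet hG
  refine ⟨⟨Matrix.toLinearEquiv' G this, fun x => ?_⟩⟩
  change A.toQuadraticForm' (G *ᵥ x) = _
  rw [toQuadraticForm'_apply, toQuadraticForm'_apply, ← mulVec_mulVec, ← mulVec_mulVec,
    dotProduct_mulVec x, vecMul_transpose]

theorem toQuadraticForm'_diagonal (d : ι → ℝ) :
    (diagonal d).toQuadraticForm' = QuadraticMap.weightedSumSquares ℝ d := by
  ext x
  rw [toQuadraticForm'_apply, QuadraticMap.weightedSumSquares_apply]
  simp only [dotProduct, mulVec_diagonal, smul_eq_mul]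
  exact Finset.sum_congr rfl fun i _ => by ring

theorem exists_orthogonal_diagonalization (A : Matrix ι ι ℝ) (hA : Aᵀ = A) :
    ∃ (U : Matrix ι ι ℝ) (d : ι → ℝ), Uᵀ * U = 1 ∧ U * Uᵀ = 1 ∧ A = U * diagonal d * Uᵀ := by
  have hA' : A.IsHermitian := by
    rwa [IsHermitian, conjTranspose_eq_transpose_of_trivial]
  refine ⟨hA'.eigenvectorUnitary, hA'.eigenvalues, ?_, ?_, ?_⟩
  · simpa [star_eq_conjTranspose, conjTranspose_eq_transpose_of_trivial]
      using Unitary.coe_star_mul_self hA'.eigenvectorUnitary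
  · simpa [star_eq_conjTranspose, conjTranspose_eq_transpose_of_trivial]
      using Unitary.coe_mul_star_self hA'.eigenvectorUnitary
  · have h := hA'.spectral_theorem
    rw [Unitary.conjStarAlgAut_apply] at h
    simpa [star_eq_conjTranspose, conjTranspose_eq_transpose_of_trivial,
      Function.comp_def] using h

theorem isUnit_det_of_mul_eq_one' (A B : Matrix ι ι ℝ) (h : A * B = 1) : IsUnit A.det :=
  (Matrix.isUnit_iff_isUnit_det _).1 (IsUnit.of_mul_eq_one _ h)

theorem idx_orthogonal_conj (A U : Matrix ι ι ℝ) (hU : Uᵀ * U = 1) :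
    idx (U * A * Uᵀ) = idx A := by
  simp only [idx]
  rw [charpoly_mul_comm, ← Matrix.mul_assoc, hU, Matrix.one_mul]

/-- Links eigenvalue counting to quadratic forms, so that Sylvester's law of inertia and negative
definite subspaces become available. -/
theorem idx_eq_sigNeg (A : Matrix ι ι ℝ) (hA : Aᵀ = A) :
    idx A = sigNeg A.toQuadraticForm' := by
  obtain ⟨U, d, h1, h2, rfl⟩ := exists_orthogonal_diagonalization A hA
  have e := equivalent_of_congr (diagonal d) Uᵀ (isUnit_det_of_mul_eq_one' _ _ h1)
  rw [transpose_transpose] at e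
  rw [e.sigNeg_eq, toQuadraticForm'_diagonal, QuadraticForm.sigNeg_weightedSumSquares,
    idx_orthogonal_conj _ _ h1, idx_diagonal]

theorem idx_congr (A G : Matrix ι ι ℝ) (hA : Aᵀ = A) (hG : IsUnit G.det) :
    idx (Gᵀ * A * G) = idx A := by
  rw [idx_eq_sigNeg _ hA, idx_eq_sigNeg, (equivalent_of_congr A G hG).sigNeg_eq]
  simp [Matrix.transpose_mul, hA, Matrix.mul_assoc]

theorem idx_add_idx_neg (A : Matrix ι ι ℝ) (hA : Aᵀ = A) : idx A + idx (-A) = A.rank := by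
  obtain ⟨U, d, h1, h2, rfl⟩ := exists_orthogonal_diagonalization A hA
  have hU := isUnit_det_of_mul_eq_one' _ _ h1
  have hU' := isUnit_det_of_mul_eq_one' _ _ h2
  rw [rank_mul_eq_left_of_isUnit_det _ _ hU, rank_mul_eq_right_of_isUnit_det _ _ hU']
  have : -(U * diagonal d * Uᵀ) = U * diagonal (-d) * Uᵀ := by
    rw [show diagonal (-d) = -diagonal d from (diagonal_neg d).symm,
      Matrix.mul_neg, Matrix.neg_mul]
  rw [this, idx_orthogonal_conj _ _ h1, idx_orthogonal_conj _ _ h1, rank_diagonal, idx_diagonal,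
    idx_diagonal, ← Nat.card_eq_fintype_card, ← Set.ncard_union_eq]
  · have h : {i | d i < 0} ∪ {i | (-d) i < 0} = {i | d i ≠ 0} := by
      ext i
      simp
    rw [h, ← Nat.card_coe_set_eq]
    rfl
  · rw [Set.disjoint_left]
    intro i hi hi'
    simp only [mem_ofPred_eq, Pi.neg_apply] at hi hi'
    linarith

theorem rank_fromBlocks_zero_of_symm (A : Matrix ι ι ℝ) (D : Matrix κ κ ℝ) (hA : Aᵀ = A)
    (hD : Dᵀ = D) : (fromBlocks A 0 0 D).rank = A.rank + D.rank := by
  rw [← idx_add_idx_neg A hA, ← idx_add_idx_neg D hD, ← idx_add_idx_neg _ (by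
    simp [fromBlocks_transpose, hA, hD]), fromBlocks_neg, neg_zero, neg_zero, idx_fromBlocks_zero,
    idx_fromBlocks_zero]
  ring

/-- Congruence by `diag(1, -1)` sends this matrix to its negative, so the index is half the rank,
and the rank is twice that of `N`. -/
theorem idx_fromBlocks_antidiag (N : Matrix ι κ ℝ) : idx (fromBlocks 0 N Nᵀ 0) = N.rank := by
  set R := fromBlocks 0 N Nᵀ 0 with hR
  have hRt : Rᵀ = R := by simp [hR, fromBlocks_transpose]
  have h1 : idx (-R) = idx R := by
    have := idx_congr R (fromBlocks 1 0 0 (-1)) hRt (by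
      refine isUnit_det_of_mul_eq_one' _ (fromBlocks 1 0 0 (-1)) ?_
      simp [fromBlocks_multiply])
    rw [← this]
    simp [hR, fromBlocks_transpose, fromBlocks_multiply, fromBlocks_neg]
  have h2 := idx_add_idx_neg R hRt
  have h3 : R.rank = N.rank + N.rank := by
    rw [← rank_transpose_mul_self, hRt, hR, fromBlocks_multiply]
    simp only [Matrix.zero_mul, Matrix.mul_zero, add_zero, zero_add]
    rw [rank_fromBlocks_zero_of_symm _ _ (by simp) (by simp), rank_transpose_mul_self,
      rank_self_mul_transpose]
  omega

-- Lower semicontinuity: a negative definite subspace of maximal dimension for `A` stays negative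
-- definite for nearby `B`, since its unit sphere is compact.
open Filter Topology in
theorem eventually_idx_le (A : Matrix ι ι ℝ) (hA : Aᵀ = A) :
    ∀ᶠ B in 𝓝 A, Bᵀ = B → idx A ≤ idx B := by
  obtain ⟨V, hV, hneg⟩ := exists_finrank_eq_sigNeg_and_negDef A.toQuadraticForm'
  have hneg' : ∀ x ∈ V, x ≠ 0 → x ⬝ᵥ A *ᵥ x < 0 := by
    intro x hx hx0
    have := hneg ⟨x, hx⟩ (by simpa using hx0)
    rw [QuadraticMap.restrict_apply, _root_.neg_apply, toQuadraticForm'_apply] at this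
    simpa using this
  have hK : IsCompact ((V : Set (ι → ℝ)) ∩ Metric.sphere 0 1) :=
    (isCompact_sphere _ _).inter_left V.closed_of_finiteDimensional
  have hev : ∀ᶠ B in 𝓝 A, ∀ x ∈ (V : Set (ι → ℝ)) ∩ Metric.sphere 0 1, x ⬝ᵥ B *ᵥ x < 0 := by
    refine hK.eventually_forall_of_forall_eventually fun x hx => ?_
    have hc : Continuous fun z : Matrix ι ι ℝ × (ι → ℝ) => z.2 ⬝ᵥ z.1 *ᵥ z.2 :=
      continuous_snd.dotProduct (continuous_fst.matrix_mulVec continuous_snd)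
    refine hc.continuousAt.eventually_lt continuousAt_const (hneg' x hx.1 ?_)
    rintro rfl
    simpa using hx.2
  filter_upwards [hev] with B hB hBt
  rw [idx_eq_sigNeg A hA, idx_eq_sigNeg B hBt, ← hV]
  refine le_sigNeg_of_negDef _ ?_
  rintro ⟨x, hx⟩ hx0
  have hx0' : x ≠ 0 := by simpa using hx0
  rw [QuadraticMap.restrict_apply, _root_.neg_apply, toQuadraticForm'_apply, neg_pos]
  have hn : 0 < ‖x‖ := norm_pos_iff.2 hx0'
  have := hB (‖x‖⁻¹ • x) ⟨V.smul_mem _ hx, by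
    rw [mem_sphere_zero_iff_norm, norm_smul, norm_inv, norm_norm, inv_mul_cancel₀ hn.ne']⟩
  rw [mulVec_smul, dotProduct_smul, smul_dotProduct, smul_eq_mul, smul_eq_mul, ← mul_assoc] at this
  exact neg_of_mul_neg_right this (by positivity)

open Filter Topology in
/-- The index of a continuous family of symmetric matrices of constant rank is locally constant. -/
theorem eventually_idx_eq {α : Type*} {l : Filter α} {S : α → Matrix ι ι ℝ} {A : Matrix ι ι ℝ}
    (hS : Tendsto S l (𝓝 A)) (hA : Aᵀ = A) (hsymm : ∀ᶠ s in l, (S s)ᵀ = S s)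
    (hrank : ∀ᶠ s in l, (S s).rank = A.rank) : ∀ᶠ s in l, idx (S s) = idx A := by
  have h1 := hS.eventually (eventually_idx_le A hA)
  -- Semicontinuity for both `A` and `-A` leaves no room for a jump, since the two indices add up to
  -- the constant rank.
  have h2 := hS.neg.eventually (eventually_idx_le (-A) (by simp [hA]))
  filter_upwards [h1, h2, hsymm, hrank] with s h1 h2 h3 h4
  have e1 := h1 h3
  have e2 := h2 (by simp [h3])
  have e3 := idx_add_idx_neg _ h3
  have e4 := idx_add_idx_neg _ hA
  omega

end Index

/-! ### Inertia of a block matrix with singular pivot. -/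

section Haynsworth

variable {ι κ : Type*} [Fintype ι] [DecidableEq ι] [Fintype κ] [DecidableEq κ]

/-- Congruence by the unipotent matrix `(1 Z; 0 1)`. -/
theorem idx_fromBlocks_shift (S : Matrix ι ι ℝ) (B Z : Matrix ι κ ℝ) (D : Matrix κ κ ℝ)
    (hS : Sᵀ = S) (hD : Dᵀ = D) :
    idx (fromBlocks S B Bᵀ D) =
      idx (fromBlocks S (B + S * Z) (B + S * Z)ᵀ (D + Zᵀ * B + Bᵀ * Z + Zᵀ * S * Z)) := by
  have h := idx_congr (fromBlocks S B Bᵀ D) (fromBlocks 1 Z 0 1)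
    (by simp [fromBlocks_transpose, hS, hD]) (by simp)
  rw [← h]
  congr 1
  simp only [fromBlocks_transpose, fromBlocks_multiply, transpose_one, transpose_zero,
    Matrix.one_mul, Matrix.mul_one, Matrix.zero_mul, Matrix.mul_zero, add_zero, transpose_add,
    transpose_mul, hS]
  congr 1
  · abel
  · abel
  · rw [Matrix.add_mul]
    abel

/-- A Haynsworth inertia formula with singular pivot. -/
theorem idx_fromBlocks_eq {n : ℕ} (S B Z D M G : Matrix (Fin n) (Fin n) ℝ)
    (hS : Sᵀ = S) (hD : Dᵀ = D) (hSM : S * M = 0) (hB : B + S * Z = M) (hG : IsMoorePenrose M G) :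
    idx (fromBlocks S B Bᵀ D) = idx S + M.rank +
      idx ((1 - G * M) * (D + Zᵀ * B + Bᵀ * Z + Zᵀ * S * Z) * (1 - G * M)) := by
  rw [idx_fromBlocks_shift S B Z D hS hD, hB]
  set D' := D + Zᵀ * B + Bᵀ * Z + Zᵀ * S * Z with hD'
  have hD't : D'ᵀ = D' := by
    simp only [hD', transpose_add, transpose_mul, transpose_transpose, hS, hD, Matrix.mul_assoc]
    abel
  clear_value D'
  set E := G * M with hE
  have hEt : Eᵀ = E := hG.symm_right
  have hME : M * E = M := by rw [hE, ← Matrix.mul_assoc, hG.mul_mul_left]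
  have hEM : E * Mᵀ = Mᵀ := by
    have := congrArg transpose hME
    rwa [transpose_mul, hEt] at this
  have hSG : S * Gᵀ = 0 := by
    have : Gᵀ = M * G * Gᵀ := by
      conv_lhs => rw [← hG.mul_mul_right, Matrix.mul_assoc, transpose_mul, hG.symm_left]
    rw [this, ← Matrix.mul_assoc, ← Matrix.mul_assoc, hSM, Matrix.zero_mul, Matrix.zero_mul]
  have hMG : Mᵀ * Gᵀ = E := by rw [← transpose_mul, hEt]
  -- The halved term makes `E F + (E F)ᵀ = D' - (1 - E) D' (1 - E)`, so a second shift, by `-Gᵀ F`,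
  -- removes the part of `D'` that `M` can absorb. It leaves the corner `M` alone because `S Gᵀ =
  -- 0`.
  set F := (1 / 2 : ℝ) • (D' * E) + D' * (1 - E) with hF
  rw [idx_fromBlocks_shift S M (-(Gᵀ * F)) D' hS hD't]
  have h1 : S * -(Gᵀ * F) = 0 := by rw [Matrix.mul_neg, ← Matrix.mul_assoc, hSG]; simp
  have h2 : Mᵀ * -(Gᵀ * F) = -(E * F) := by rw [Matrix.mul_neg, ← Matrix.mul_assoc, hMG]
  have h3 : (-(Gᵀ * F))ᵀ * M = -(E * F)ᵀ := by
    rw [← transpose_neg, ← h2, transpose_mul (Mᵀ), transpose_transpose]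
  rw [Matrix.mul_assoc _ S, h1, h2, h3, Matrix.mul_zero, add_zero, add_zero]
  have h4 : D' + -(E * F)ᵀ + -(E * F) = (1 - E) * D' * (1 - E) := by
    have hF2 : (E * F)ᵀ = (1 / 2 : ℝ) • (E * D' * E) + (1 - E) * D' * E := by
      simp only [hF, transpose_mul, transpose_add, transpose_smul, transpose_sub, transpose_one,
        hEt, hD't]
      simp only [Matrix.add_mul, Matrix.smul_mul]
    rw [hF2, hF]
    simp only [Matrix.sub_mul, Matrix.mul_sub, Matrix.one_mul, Matrix.mul_one, Matrix.mul_add,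
      Matrix.mul_smul, Matrix.mul_assoc]
    module
  rw [h4]
  -- The two summands have product zero, by `S M = 0` and `(1 - E) Mᵀ = 0`, so their indices add.
  have h5 : fromBlocks S M Mᵀ ((1 - E) * D' * (1 - E)) =
      fromBlocks S 0 0 ((1 - E) * D' * (1 - E)) + fromBlocks 0 M Mᵀ 0 := by
    simp [fromBlocks_add]
  rw [h5, idx_add_of_mul_eq_zero, idx_fromBlocks_zero, idx_fromBlocks_antidiag]
  · ring
  · rw [fromBlocks_multiply]
    simp [hSM, Matrix.mul_assoc, Matrix.sub_mul, hEM]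

end Haynsworth

/-! ### Charts of Lagrangian planes and the comparative index in them. -/

section Chart

variable {n : ℕ}

theorem IsMoorePenrose.smul {A B : Matrix (Fin n) (Fin n) ℝ} (h : IsMoorePenrose A B) {c : ℝ}
    (hc : c * c = 1) : IsMoorePenrose (c • A) (c • B) := by
  refine ⟨?_, ?_, ?_, ?_⟩ <;>
    simp only [Matrix.smul_mul, Matrix.mul_smul, smul_smul, hc, one_smul, h.1, h.2, h.3,
      h.4]

/-- The matrix `U - c X` for `Y = (X; U)`, the Wronskian of the plane `(I; c I)` and `Y`. -/
def chartDen (c : ℝ) (Y : Matrix (Fin n ⊕ Fin n) (Fin n) ℝ) : Matrix (Fin n) (Fin n) ℝ :=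
  Y.toRows₂ - c • Y.toRows₁

/-- The coordinate `X (U - c X)⁻¹` of `Y = (X; U)` in the chart of Lagrangian planes transversal
to `(I; c I)`. -/
noncomputable def chart (c : ℝ) (Y : Matrix (Fin n ⊕ Fin n) (Fin n) ℝ) :
    Matrix (Fin n) (Fin n) ℝ :=
  Y.toRows₁ * (chartDen c Y)⁻¹

theorem wronskian_eq (Y A : Matrix (Fin n ⊕ Fin n) (Fin n) ℝ) :
    wronskian Y A = Y.toRows₁ᵀ * A.toRows₂ - Y.toRows₂ᵀ * A.toRows₁ := by
  conv_lhs => rw [← fromRows_toRows Y, ← fromRows_toRows A]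
  rw [wronskian, skewJ, transpose_fromRows, fromCols_mul_fromBlocks, fromCols_mul_fromRows]
  simp only [Matrix.mul_zero, Matrix.mul_one, Matrix.mul_neg, zero_add, add_zero, Matrix.neg_mul]
  abel

/-- The shear `(X, U) ↦ (X, U - c X)` is symplectic. -/
theorem wronskian_eq_chartDen (c : ℝ) (Y A : Matrix (Fin n ⊕ Fin n) (Fin n) ℝ) :
    wronskian Y A = Y.toRows₁ᵀ * chartDen c A - (chartDen c Y)ᵀ * A.toRows₁ := by
  rw [wronskian_eq, chartDen, chartDen, transpose_sub, transpose_smul, Matrix.mul_sub,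
    Matrix.sub_mul, Matrix.mul_smul, Matrix.smul_mul]
  abel

variable {c : ℝ} {Y A : Matrix (Fin n ⊕ Fin n) (Fin n) ℝ}

theorem upper_transpose_mul_chartDen (hY : wronskian Y Y = 0) :
    Y.toRows₁ᵀ * chartDen c Y = (chartDen c Y)ᵀ * Y.toRows₁ := by
  rw [wronskian_eq_chartDen c, sub_eq_zero] at hY
  exact hY

theorem chart_mul_chartDen (hK : IsUnit (chartDen c Y).det) :
    chart c Y * chartDen c Y = Y.toRows₁ := by
  rw [chart, Matrix.mul_assoc, nonsing_inv_mul _ hK, Matrix.mul_one]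

theorem transpose_chart (hY : wronskian Y Y = 0) (hK : IsUnit (chartDen c Y).det) :
    (chart c Y)ᵀ = chart c Y := by
  have h := upper_transpose_mul_chartDen (c := c) hY
  have hK' : IsUnit (chartDen c Y)ᵀ.det := by rwa [det_transpose]
  calc (chart c Y)ᵀ = ((chartDen c Y)ᵀ)⁻¹ * (Y.toRows₁ᵀ * chartDen c Y) * (chartDen c Y)⁻¹ := by
        rw [chart, transpose_mul, transpose_nonsing_inv, Matrix.mul_assoc, Matrix.mul_assoc,
          mul_nonsing_inv _ hK, Matrix.mul_one]
    _ = chart c Y := by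
        rw [h, ← Matrix.mul_assoc, nonsing_inv_mul _ hK', Matrix.one_mul, chart]

theorem rank_chart (hK : IsUnit (chartDen c Y).det) : (chart c Y).rank = Y.toRows₁.rank := by
  rw [← chart_mul_chartDen hK, rank_mul_eq_left_of_isUnit_det _ _ hK]

theorem wronskian_eq_chart (hY : wronskian Y Y = 0) (hKY : IsUnit (chartDen c Y).det)
    (hKA : IsUnit (chartDen c A).det) :
    wronskian Y A = (chartDen c Y)ᵀ * (chart c Y - chart c A) * chartDen c A := by
  rw [wronskian_eq_chartDen c, Matrix.mul_sub, Matrix.sub_mul, Matrix.mul_assoc _ (chart c A),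
    chart_mul_chartDen hKA]
  congr 2
  conv_lhs => rw [← chart_mul_chartDen hKY, transpose_mul, transpose_chart hY hKY]

theorem rank_chart_sub_chart (hY : wronskian Y Y = 0) (hKY : IsUnit (chartDen c Y).det)
    (hKA : IsUnit (chartDen c A).det) :
    (chart c Y - chart c A).rank = (wronskian Y A).rank := by
  rw [wronskian_eq_chart hY hKY hKA, rank_mul_eq_left_of_isUnit_det _ _ hKA,
    rank_mul_eq_right_of_isUnit_det _ _ (by rwa [det_transpose])]

theorem idx_fromBlocks_self (S T : Matrix (Fin n) (Fin n) ℝ) (hS : Sᵀ = S) (hT : Tᵀ = T) :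
    idx (fromBlocks S T T T) = idx (S - T) + idx T := by
  have h := idx_congr (fromBlocks S T T T) (fromBlocks 1 0 (-1) 1)
    (by simp [fromBlocks_transpose, hS, hT]) (by simp)
  rw [← h, ← idx_fromBlocks_zero]
  congr 1
  simp [fromBlocks_transpose, fromBlocks_multiply, sub_eq_add_neg]

/-- The comparative indices in a chart: the common form of `compIndex_add_idx_chart` and
`dualCompIndex_add_idx_chart`. -/
theorem rank_compM_add_idx (hY : wronskian Y Y = 0) (hA : wronskian A A = 0)
    (hKY : IsUnit (chartDen c Y).det) (hKA : IsUnit (chartDen c A).det) {e : ℝ} (he : e * e = 1) :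
    (compM Y A).rank + idx (e • compP Y A) + idx (e • chart c Y) =
      idx (e • chart c A) + idx (e • (chart c Y - chart c A)) := by
  -- The matrix with blocks `KᵀX, KᵀX', X'ᵀK, K'ᵀX'`, times the sign `e`, is evaluated twice. It is
  -- congruent to `(σ τ; τ τ)`, which gives `ind τ + ind (σ - τ)`; the Haynsworth formula with pivot
  -- `KᵀX` gives `ind σ + rank M + ind P`. The choices `e = 1` and `e = -1` yield the two
  -- comparative indices.
  have hσ := transpose_chart hY hKY
  have hτ := transpose_chart hA hKA
  have hXK := upper_transpose_mul_chartDen (c := c) hY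
  have hXK' := upper_transpose_mul_chartDen (c := c) hA
  have hW := wronskian_eq_chartDen c Y A
  have hσK := chart_mul_chartDen hKY
  have hτK := chart_mul_chartDen hKA
  have hMP := pinv_spec (compM Y A)
  have hp := pinv_spec Y.toRows₁
  have hM : compM Y A = (1 - pinv Y.toRows₁ * Y.toRows₁) * wronskian Y A := rfl
  have hP : compP Y A = (1 - pinv (compM Y A) * compM Y A) * (wronskian Y A)ᵀ * pinv Y.toRows₁ *
      A.toRows₁ * (1 - pinv (compM Y A) * compM Y A) := rfl
  have hKL := mul_nonsing_inv _ hKY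
  set σ := chart c Y
  set τ := chart c A
  set K := chartDen c Y
  set K' := chartDen c A
  set X := Y.toRows₁
  set X' := A.toRows₁
  set W := wronskian Y A
  set M := compM Y A
  set G := pinv M
  set p := pinv X
  set L := K⁻¹
  set V := 1 - G * M with hV
  have hVt : Vᵀ = V := by rw [hV, transpose_sub, transpose_one, hMP.symm_right]
  have hMV : M * V = 0 := by
    rw [hV, Matrix.mul_sub, Matrix.mul_one, ← Matrix.mul_assoc, hMP.mul_mul_left, sub_self]
  have hM' : M = -((1 - p * X) * (Kᵀ * X')) := by
    have : (1 - p * X) * Xᵀ = 0 := by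
      rw [← hp.symm_right, Matrix.sub_mul, ← transpose_mul, ← Matrix.mul_assoc, hp.mul_mul_left,
        Matrix.one_mul, sub_self]
    rw [hM, hW, Matrix.mul_sub, ← Matrix.mul_assoc, this, Matrix.zero_mul, zero_sub]
  have hXM : X * M = 0 := by
    rw [hM, ← Matrix.mul_assoc, Matrix.mul_sub, ← Matrix.mul_assoc, hp.mul_mul_left,
      Matrix.mul_one, sub_self, Matrix.zero_mul]
  -- Chosen so that `KᵀX Z` cancels the component of `KᵀX'` in the range of `p X`; what is left of
  -- the off-diagonal block is `-M`, which `X` annihilates.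
  set Z := -(L * (pᵀ * (Kᵀ * X'))) with hZ
  have hSZ : Kᵀ * X * Z = -(p * X * (Kᵀ * X')) := by
    rw [← hXK, hZ, Matrix.mul_neg, Matrix.mul_assoc, ← Matrix.mul_assoc K, hKL, Matrix.one_mul,
      ← Matrix.mul_assoc, ← transpose_mul, hp.symm_right]
  have hBZ : Kᵀ * X' + Kᵀ * X * Z = -M := by
    rw [hSZ, hM', neg_neg, Matrix.sub_mul, Matrix.one_mul, sub_eq_add_neg]
  have hXZV : X * (Z * V) = -(X' * V) := by
    have h1 : Kᵀ * (X * (Z * V)) = Kᵀ * (-(X' * V)) := by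
      have := congrArg (· * V) hBZ
      simp only [Matrix.add_mul, Matrix.neg_mul, hMV, neg_zero] at this
      rw [Matrix.mul_neg, ← Matrix.mul_assoc, ← Matrix.mul_assoc, ← Matrix.mul_assoc]
      exact eq_neg_of_add_eq_zero_right this
    have h2 := congrArg (Lᵀ * ·) h1
    simpa only [← Matrix.mul_assoc Lᵀ, ← transpose_mul, hKL, transpose_one, Matrix.one_mul]
      using h2
  have hVZX : V * Zᵀ * Xᵀ = -(V * X'ᵀ) := by
    have := congrArg transpose hXZV
    simpa only [transpose_mul, transpose_neg, hVt, Matrix.mul_assoc] using this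
  have hVDV : V * (K'ᵀ * X' + Zᵀ * (Kᵀ * X') + (Kᵀ * X')ᵀ * Z + Zᵀ * (Kᵀ * X) * Z) * V =
      compP Y A := by
    have hX'V : X' * V = -(X * (Z * V)) := by rw [hXZV, neg_neg]
    have hVX' : V * X'ᵀ = -(V * Zᵀ * Xᵀ) := by rw [hVZX, neg_neg]
    -- On the range of `V` one may replace `X'` by `-X Z`; every term then reduces to `V Zᵀ KᵀX Z V`
    -- or `V K'ᵀX' V`.
    have e1 : V * (Zᵀ * (Kᵀ * X')) * V = -(V * Zᵀ * Kᵀ * X * Z * V) := by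
      calc V * (Zᵀ * (Kᵀ * X')) * V = V * Zᵀ * Kᵀ * (X' * V) := by simp only [Matrix.mul_assoc]
        _ = _ := by rw [hX'V]; simp only [Matrix.mul_assoc, Matrix.mul_neg]
    have e2 : V * ((Kᵀ * X')ᵀ * Z) * V = -(V * Zᵀ * Kᵀ * X * Z * V) := by
      calc V * ((Kᵀ * X')ᵀ * Z) * V = (V * X'ᵀ) * K * Z * V := by
            simp only [transpose_mul, transpose_transpose, Matrix.mul_assoc]
        _ = -(V * Zᵀ * (Xᵀ * K) * Z * V) := by
            rw [hVX']; simp only [Matrix.mul_assoc, Matrix.neg_mul]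
        _ = _ := by rw [hXK]; simp only [Matrix.mul_assoc]
    have e3 : V * (K'ᵀ * X * p * X') * V = V * (K'ᵀ * X') * V := by
      calc V * (K'ᵀ * X * p * X') * V = V * K'ᵀ * X * p * (X' * V) := by
            simp only [Matrix.mul_assoc]
        _ = -(V * K'ᵀ * (X * p * X) * (Z * V)) := by
            rw [hX'V]; simp only [Matrix.mul_assoc, Matrix.mul_neg]
        _ = V * K'ᵀ * -(X * (Z * V)) := by
            rw [hp.mul_mul_left]; simp only [Matrix.mul_assoc, Matrix.mul_neg]
        _ = _ := by rw [← hX'V]; simp only [Matrix.mul_assoc]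
    have e4 : V * (X'ᵀ * K * p * X') * V = V * Zᵀ * Kᵀ * X * Z * V := by
      calc V * (X'ᵀ * K * p * X') * V = (V * X'ᵀ) * K * p * (X' * V) := by
            simp only [Matrix.mul_assoc]
        _ = V * Zᵀ * (Xᵀ * K) * p * (X * (Z * V)) := by
            rw [hX'V, hVX']; simp only [Matrix.mul_assoc, Matrix.mul_neg, Matrix.neg_mul, neg_neg]
        _ = V * Zᵀ * Kᵀ * (X * p * X) * (Z * V) := by
            rw [hXK]; simp only [Matrix.mul_assoc]
        _ = _ := by rw [hp.mul_mul_left]; simp only [Matrix.mul_assoc]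
    have e5 : compP Y A = V * (K'ᵀ * X * p * X') * V - V * (X'ᵀ * K * p * X') * V := by
      rw [hP, hW, transpose_sub, transpose_mul, transpose_mul, transpose_transpose,
        transpose_transpose]
      simp only [Matrix.mul_assoc, Matrix.mul_sub, Matrix.sub_mul]
    rw [e5, e3, e4]
    simp only [Matrix.mul_add, Matrix.add_mul]
    rw [e1, e2]
    simp only [Matrix.mul_assoc]
    abel
  have hMP' : IsMoorePenrose (-e • M) (-e • G) := hMP.smul (by linarith)
  have key := idx_fromBlocks_eq (e • (Kᵀ * X)) (e • (Kᵀ * X')) Z (e • (K'ᵀ * X')) (-e • M) (-e • G)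
    (by rw [transpose_smul, transpose_mul, transpose_transpose, hXK])
    (by rw [transpose_smul, transpose_mul, transpose_transpose, hXK'])
    (by rw [Matrix.smul_mul, Matrix.mul_smul, Matrix.mul_assoc, hXM]; simp)
    (by rw [Matrix.smul_mul, ← smul_add, hBZ, smul_neg, neg_smul]) hMP'
  have hV' : 1 - -e • G * -e • M = V := by
    rw [Matrix.smul_mul, Matrix.mul_smul, smul_smul, neg_mul_neg, he, one_smul]
  have hD : e • (K'ᵀ * X') + Zᵀ * e • (Kᵀ * X') + (e • (Kᵀ * X'))ᵀ * Z + Zᵀ * e • (Kᵀ * X) * Z =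
      e • (K'ᵀ * X' + Zᵀ * (Kᵀ * X') + (Kᵀ * X')ᵀ * Z + Zᵀ * (Kᵀ * X) * Z) := by
    simp only [Matrix.smul_mul, Matrix.mul_smul, transpose_smul, smul_add]
  have hrank : (-e • M).rank = M.rank := by
    have h1 : (-e) * (-e) = 1 := by linarith
    have h2 : IsUnit ((-e) • (1 : Matrix (Fin n) (Fin n) ℝ)).det :=
      isUnit_det_of_mul_eq_one' _ ((-e) • 1) (by
        rw [Matrix.smul_mul, Matrix.mul_smul, smul_smul, h1, one_smul, Matrix.one_mul])
    rw [← rank_mul_eq_right_of_isUnit_det _ M h2, Matrix.smul_mul, Matrix.one_mul]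
  rw [hV', hD, Matrix.mul_smul, Matrix.smul_mul, hVDV, hrank] at key
  have hH : fromBlocks (e • (Kᵀ * X)) (e • (Kᵀ * X')) (e • (Kᵀ * X'))ᵀ (e • (K'ᵀ * X')) =
      (fromBlocks K 0 0 K')ᵀ * fromBlocks (e • σ) (e • τ) (e • τ) (e • τ) *
        fromBlocks K 0 0 K' := by
    have hX't : X'ᵀ = K'ᵀ * τ := by rw [← hτK, transpose_mul, hτ]
    simp only [fromBlocks_transpose, fromBlocks_multiply, transpose_zero, Matrix.mul_zero,
      Matrix.zero_mul, add_zero, zero_add, smul_zero, Matrix.mul_smul, Matrix.smul_mul,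
      Matrix.mul_assoc, hσK, hτK, transpose_smul, transpose_mul, transpose_transpose, hX't]
  have hσe : idx (e • (Kᵀ * X)) = idx (e • σ) := by
    rw [← idx_congr (e • σ) K (by rw [transpose_smul, hσ]) hKY]
    rw [Matrix.mul_smul, Matrix.smul_mul, Matrix.mul_assoc, hσK]
  rw [hH, idx_congr _ _ (by simp [fromBlocks_transpose, hσ, hτ]) (by
      rw [det_fromBlocks_zero₂₁]; exact hKY.mul hKA),
    idx_fromBlocks_self _ _ (by rw [transpose_smul, hσ]) (by rw [transpose_smul, hτ]), hσe,
    ← smul_sub] at key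
  omega

theorem compIndex_add_idx_chart (hY : wronskian Y Y = 0) (hA : wronskian A A = 0)
    (hKY : IsUnit (chartDen c Y).det) (hKA : IsUnit (chartDen c A).det) :
    compIndex Y A + idx (chart c Y) = idx (chart c A) + idx (chart c Y - chart c A) := by
  have h := rank_compM_add_idx hY hA hKY hKA (e := 1) (by norm_num)
  simp only [one_smul] at h
  exact h

theorem dualCompIndex_add_idx_chart (hY : wronskian Y Y = 0) (hA : wronskian A A = 0)
    (hKY : IsUnit (chartDen c Y).det) (hKA : IsUnit (chartDen c A).det) :
    dualCompIndex Y A + idx (-chart c Y) =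
      idx (-chart c A) + idx (-(chart c Y - chart c A)) := by
  have h := rank_compM_add_idx hY hA hKY hKA (e := -1) (by norm_num)
  simp only [neg_smul, one_smul] at h
  exact h

-- The determinant of `U - c X` is a polynomial in `c`, nonzero at `c = i`: the Lagrangian condition
-- gives `(U + iX)ᵀ (U - iX) = YᵀY`, which is invertible because `Y` has full rank.
open Polynomial in
theorem finite_setOf_not_isUnit_chartDen (hY : IsLagrangianPlane Y) :
    {c : ℝ | ¬ IsUnit (chartDen c Y).det}.Finite := by
  set q : ℝ[X] := ((C : ℝ →+* ℝ[X]).mapMatrix Y.toRows₂ -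
    (X : ℝ[X]) • (C : ℝ →+* ℝ[X]).mapMatrix Y.toRows₁).det with hq
  have heval : ∀ c : ℝ, q.eval c = (chartDen c Y).det := by
    intro c
    rw [hq, ← coe_evalRingHom, RingHom.map_det]
    congr 1
    ext i j
    simp [chartDen, mul_comm c]
  have hq0 : q ≠ 0 := by
    intro h0
    have h1 : aeval Complex.I q = 0 := by rw [h0, map_zero]
    set N : Matrix (Fin n) (Fin n) ℂ := Y.toRows₂.map Complex.ofReal -
      Complex.I • Y.toRows₁.map Complex.ofReal with hN
    have h2 : aeval Complex.I q = N.det := by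
      rw [hq, AlgHom.map_det]
      congr 1
      ext i j
      simp [hN, mul_comm Complex.I]
    have h3 : (Y.toRows₂.map Complex.ofReal + Complex.I • Y.toRows₁.map Complex.ofReal)ᵀ * N =
        (Yᵀ * Y).map Complex.ofReal := by
      have hw : Y.toRows₁ᵀ * Y.toRows₂ = Y.toRows₂ᵀ * Y.toRows₁ := by
        have := wronskian_eq Y Y
        rw [show wronskian Y Y = 0 from hY.1] at this
        exact (sub_eq_zero.1 this.symm)
      have hw' := congrArg (fun A => A.map Complex.ofRealHom) hw
      have hYY : Yᵀ * Y = Y.toRows₁ᵀ * Y.toRows₁ + Y.toRows₂ᵀ * Y.toRows₂ := by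
        conv_lhs => rw [← fromRows_toRows Y]
        rw [transpose_fromRows, fromCols_mul_fromRows]
      rw [hYY]
      change _ = (Y.toRows₁ᵀ * Y.toRows₁ + Y.toRows₂ᵀ * Y.toRows₂).map Complex.ofRealHom
      simp only [Matrix.map_mul, Matrix.map_add _ (map_add Complex.ofRealHom)] at hw' ⊢
      simp only [hN, transpose_add, transpose_smul, Matrix.mul_sub, Matrix.add_mul,
        Matrix.smul_mul, Matrix.mul_smul, smul_add, smul_smul, Complex.I_mul_I,
        ← transpose_map] at hw' ⊢
      change _ = Y.toRows₁ᵀ.map Complex.ofReal * Y.toRows₁.map Complex.ofReal +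
        Y.toRows₂ᵀ.map Complex.ofReal * Y.toRows₂.map Complex.ofReal
      change Y.toRows₁ᵀ.map Complex.ofReal * Y.toRows₂.map Complex.ofReal =
        Y.toRows₂ᵀ.map Complex.ofReal * Y.toRows₁.map Complex.ofReal at hw'
      rw [hw', neg_one_smul]
      abel
    have h4 := congrArg det h3
    rw [det_mul, ← h2, h1, mul_zero] at h4
    have h5 : ((Yᵀ * Y).map Complex.ofRealHom).det = 0 := h4.symm
    rw [← RingHom.mapMatrix_apply, ← RingHom.map_det, map_eq_zero] at h5
    have h6 : (Yᵀ * Y).rank = n := by rw [rank_transpose_mul_self, hY.2]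
    obtain ⟨v, hv, hv'⟩ := exists_mulVec_eq_zero_iff.2 h5
    have h7 := LinearMap.finrank_range_add_finrank_ker (Yᵀ * Y).mulVecLin
    have h8 : Module.finrank ℝ (LinearMap.range (Yᵀ * Y).mulVecLin) = n := h6
    rw [h8, Module.finrank_fin_fun] at h7
    have h9 : LinearMap.ker (Yᵀ * Y).mulVecLin = ⊥ := Submodule.finrank_eq_zero.1 (by omega)
    exact hv (by
      have : v ∈ LinearMap.ker (Yᵀ * Y).mulVecLin := hv'
      rwa [h9, Submodule.mem_bot] at this)
  refine (q.roots.toFinset.finite_toSet).subset fun c hc => ?_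
  simp only [mem_ofPred_eq, isUnit_iff_ne_zero, not_not] at hc
  simp [hq0, heval, hc]

/-- Finitely many Lagrangian planes lie in a common chart. -/
theorem exists_forall_isUnit_chartDen {s : Set (Matrix (Fin n ⊕ Fin n) (Fin n) ℝ)} (hs : s.Finite)
    (h : ∀ Y ∈ s, IsLagrangianPlane Y) : ∃ c : ℝ, ∀ Y ∈ s, IsUnit (chartDen c Y).det := by
  have hf : (⋃ Y ∈ s, {c : ℝ | ¬ IsUnit (chartDen c Y).det}).Finite :=
    hs.biUnion fun Y hY => finite_setOf_not_isUnit_chartDen (h Y hY)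
  obtain ⟨c, hc⟩ := hf.infinite_compl.nonempty
  refine ⟨c, fun Y hY => ?_⟩
  by_contra hcon
  exact hc (mem_biUnion hY hcon)

/-- The sum of the comparative index and the dual comparative index. -/
theorem compIndex_add_dualCompIndex (hY : IsLagrangianPlane Y) (hA : IsLagrangianPlane A) :
    compIndex Y A + dualCompIndex Y A + Y.toRows₁.rank = A.toRows₁.rank + (wronskian Y A).rank := by
  obtain ⟨c, hc⟩ := exists_forall_isUnit_chartDen (s := {Y, A}) (by simp) (by simp [hY, hA])
  have hKY := hc Y (by simp)
  have hKA := hc A (by simp)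
  have hσ := transpose_chart hY.1 hKY
  have hτ := transpose_chart hA.1 hKA
  have h1 := compIndex_add_idx_chart hY.1 hA.1 hKY hKA
  have h2 := dualCompIndex_add_idx_chart hY.1 hA.1 hKY hKA
  rw [← rank_chart hKY, ← rank_chart hKA, ← rank_chart_sub_chart hY.1 hKY hKA,
    ← idx_add_idx_neg _ hσ, ← idx_add_idx_neg _ hτ,
    ← idx_add_idx_neg _ (by rw [transpose_sub, hσ, hτ])]
  omega

end Chart

/-! ### Symplectic invariance and local constancy in a chart. -/

section Local

variable {n : ℕ}

theorem transpose_wronskian (Y A : Matrix (Fin n ⊕ Fin n) (Fin n) ℝ) :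
    (wronskian Y A)ᵀ = -wronskian A Y := by
  rw [wronskian_eq, wronskian_eq, transpose_sub, transpose_mul, transpose_mul,
    transpose_transpose, transpose_transpose, neg_sub]

theorem rank_neg_real {ι : Type*} [Fintype ι] [DecidableEq ι] (M : Matrix ι ι ℝ) :
    (-M).rank = M.rank := by
  have h : IsUnit (-1 : Matrix ι ι ℝ).det := isUnit_det_of_mul_eq_one' _ (-1) (by simp)
  rw [← rank_mul_eq_right_of_isUnit_det _ M h, Matrix.neg_mul, Matrix.one_mul]

theorem rank_wronskian_comm (Y A : Matrix (Fin n ⊕ Fin n) (Fin n) ℝ) :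
    (wronskian Y A).rank = (wronskian A Y).rank := by
  rw [← rank_transpose, transpose_wronskian, rank_neg_real]

theorem wronskian_symplectic {S : Matrix (Fin n ⊕ Fin n) (Fin n ⊕ Fin n) ℝ}
    (hS : S ∈ Matrix.symplecticGroup (Fin n) ℝ) (Y A : Matrix (Fin n ⊕ Fin n) (Fin n) ℝ) :
    wronskian (S * Y) (S * A) = wronskian Y A := by
  rw [mem_symplecticGroup_iff_skewJ] at hS
  calc wronskian (S * Y) (S * A) = Yᵀ * (Sᵀ * skewJ n * S) * A := by
        simp only [wronskian, transpose_mul, Matrix.mul_assoc]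
    _ = wronskian Y A := by rw [hS, wronskian]

theorem IsLagrangianPlane.symplectic_mul {S : Matrix (Fin n ⊕ Fin n) (Fin n ⊕ Fin n) ℝ}
    (hS : S ∈ Matrix.symplecticGroup (Fin n) ℝ) {Y : Matrix (Fin n ⊕ Fin n) (Fin n) ℝ}
    (hY : IsLagrangianPlane Y) : IsLagrangianPlane (S * Y) := by
  refine ⟨(wronskian_symplectic hS Y Y).trans hY.1, ?_⟩
  rw [rank_mul_eq_right_of_isUnit_det _ _ (SymplecticGroup.symplectic_det hS), hY.2]

theorem rank_eq_of_mul_eq_one {Y : Matrix (Fin n ⊕ Fin n) (Fin n) ℝ}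
    {B : Matrix (Fin n) (Fin n ⊕ Fin n) ℝ} (h : B * Y = 1) : Y.rank = n := by
  refine le_antisymm (by simpa using rank_le_card_width Y) ?_
  have := rank_mul_le_right B Y
  rwa [h, rank_one, Fintype.card_fin] at this

theorem isLagrangianPlane_vertE : IsLagrangianPlane (vertE n) := by
  refine ⟨?_, rank_eq_of_mul_eq_one (B := (vertE n)ᵀ) ?_⟩
  · change wronskian _ _ = 0
    simp [wronskian_eq, vertE]
  · simp [vertE, transpose_fromRows, fromCols_mul_fromRows]

theorem isLagrangianPlane_fromRows_one {Q : Matrix (Fin n) (Fin n) ℝ} (hQ : Qᵀ = Q) :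
    IsLagrangianPlane (fromRows 1 Q) := by
  refine ⟨?_, rank_eq_of_mul_eq_one (B := fromCols 1 0) ?_⟩
  · change wronskian _ _ = 0
    simp [wronskian_eq, hQ]
  · simp [fromCols_mul_fromRows]

theorem continuous_toRows₁ : Continuous
    (toRows₁ : Matrix (Fin n ⊕ Fin n) (Fin n) ℝ → Matrix (Fin n) (Fin n) ℝ) :=
  continuous_id.matrix_submatrix Sum.inl id

theorem continuous_toRows₂ : Continuous
    (toRows₂ : Matrix (Fin n ⊕ Fin n) (Fin n) ℝ → Matrix (Fin n) (Fin n) ℝ) :=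
  continuous_id.matrix_submatrix Sum.inr id

theorem continuous_chartDen (c : ℝ) : Continuous
    (chartDen c : Matrix (Fin n ⊕ Fin n) (Fin n) ℝ → Matrix (Fin n) (Fin n) ℝ) :=
  continuous_toRows₂.sub (continuous_toRows₁.const_smul c)

theorem continuousAt_chart {c : ℝ} {Y : Matrix (Fin n ⊕ Fin n) (Fin n) ℝ}
    (hK : IsUnit (chartDen c Y).det) : ContinuousAt (chart c) Y := by
  have hd : ContinuousAt (fun Y => (chartDen c Y).det) Y :=
    (continuous_chartDen c).matrix_det.continuousAt
  have h : ContinuousAt (fun Y => (chartDen c Y)⁻¹) Y := by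
    simp only [Matrix.inv_def, Ring.inverse_eq_inv']
    exact (hd.inv₀ hK.ne_zero).smul (continuous_chartDen c).matrix_adjugate.continuousAt
  exact ContinuousAt.mul continuous_toRows₁.continuousAt h

open Filter Topology

theorem eventually_isUnit_chartDen {c : ℝ} {Y : Matrix (Fin n ⊕ Fin n) (Fin n) ℝ}
    (hK : IsUnit (chartDen c Y).det) : ∀ᶠ Z in 𝓝 Y, IsUnit (chartDen c Z).det := by
  simp only [isUnit_iff_ne_zero] at hK ⊢
  exact (continuous_chartDen c).matrix_det.continuousAt.eventually_ne hK

theorem eventually_idx_chart_eq {α : Type*} {l : Filter α}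
    {Y : α → Matrix (Fin n ⊕ Fin n) (Fin n) ℝ} {Y₀ : Matrix (Fin n ⊕ Fin n) (Fin n) ℝ} {c : ℝ}
    (hY : Tendsto Y l (𝓝 Y₀)) (hY₀ : wronskian Y₀ Y₀ = 0)
    (hYl : ∀ᶠ s in l, wronskian (Y s) (Y s) = 0) (hK : IsUnit (chartDen c Y₀).det)
    (hr : ∀ᶠ s in l, (Y s).toRows₁.rank = Y₀.toRows₁.rank) :
    ∀ᶠ s in l, idx (chart c (Y s)) = idx (chart c Y₀) := by
  have hK' := hY.eventually (eventually_isUnit_chartDen hK)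
  refine eventually_idx_eq ((continuousAt_chart hK).tendsto.comp hY) (transpose_chart hY₀ hK) ?_ ?_
  · filter_upwards [hYl, hK'] with s h1 h2 using transpose_chart h1 h2
  · filter_upwards [hr, hK'] with s h1 h2
    rw [rank_chart h2, rank_chart hK, h1]

theorem eventually_idx_chart_sub_chart_eq {α : Type*} {l : Filter α}
    {Y A : α → Matrix (Fin n ⊕ Fin n) (Fin n) ℝ} {Y₀ A₀ : Matrix (Fin n ⊕ Fin n) (Fin n) ℝ}
    {c : ℝ} (hY : Tendsto Y l (𝓝 Y₀)) (hA : Tendsto A l (𝓝 A₀))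
    (hY₀ : wronskian Y₀ Y₀ = 0) (hA₀ : wronskian A₀ A₀ = 0)
    (hYl : ∀ᶠ s in l, wronskian (Y s) (Y s) = 0) (hAl : ∀ᶠ s in l, wronskian (A s) (A s) = 0)
    (hKY : IsUnit (chartDen c Y₀).det) (hKA : IsUnit (chartDen c A₀).det)
    (hr : ∀ᶠ s in l, (wronskian (Y s) (A s)).rank = (wronskian Y₀ A₀).rank) :
    ∀ᶠ s in l, idx (chart c (Y s) - chart c (A s)) = idx (chart c Y₀ - chart c A₀) := by
  have hKY' := hY.eventually (eventually_isUnit_chartDen hKY)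
  have hKA' := hA.eventually (eventually_isUnit_chartDen hKA)
  refine eventually_idx_eq (((continuousAt_chart hKY).tendsto.comp hY).sub
    ((continuousAt_chart hKA).tendsto.comp hA)) ?_ ?_ ?_
  · rw [transpose_sub, transpose_chart hY₀ hKY, transpose_chart hA₀ hKA]
  · filter_upwards [hYl, hAl, hKY', hKA'] with s h1 h2 h3 h4
    rw [transpose_sub, transpose_chart h1 h3, transpose_chart h2 h4]
  · filter_upwards [hYl, hr, hKY', hKA'] with s h1 h2 h3 h4
    rw [rank_chart_sub_chart h1 h3 h4, rank_chart_sub_chart hY₀ hKY hKA, h2]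

/-- Local variation of the comparative index along a pair of paths whose Wronskian has constant
rank. -/
theorem eventually_compIndex_add_idx_chart {α : Type*} {l : Filter α}
    {Y A : α → Matrix (Fin n ⊕ Fin n) (Fin n) ℝ} {Y₀ A₀ : Matrix (Fin n ⊕ Fin n) (Fin n) ℝ}
    {c : ℝ} (hY : Tendsto Y l (𝓝 Y₀)) (hA : Tendsto A l (𝓝 A₀))
    (hY₀ : wronskian Y₀ Y₀ = 0) (hA₀ : wronskian A₀ A₀ = 0)
    (hYl : ∀ᶠ s in l, wronskian (Y s) (Y s) = 0) (hAl : ∀ᶠ s in l, wronskian (A s) (A s) = 0)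
    (hKY : IsUnit (chartDen c Y₀).det) (hKA : IsUnit (chartDen c A₀).det)
    (hr : ∀ᶠ s in l, (wronskian (Y s) (A s)).rank = (wronskian Y₀ A₀).rank) :
    ∀ᶠ s in l, (compIndex (Y s) (A s) : ℤ) + idx (chart c (Y s)) - idx (chart c (A s)) =
      compIndex Y₀ A₀ + idx (chart c Y₀) - idx (chart c A₀) := by
  filter_upwards [hYl, hAl, hY.eventually (eventually_isUnit_chartDen hKY),
    hA.eventually (eventually_isUnit_chartDen hKA),
    eventually_idx_chart_sub_chart_eq hY hA hY₀ hA₀ hYl hAl hKY hKA hr] with s h1 h2 h3 h4 h5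
  have e1 := compIndex_add_idx_chart h1 h2 h3 h4
  have e2 := compIndex_add_idx_chart hY₀ hA₀ hKY hKA
  omega

end Local

/-! ### Oscillation numbers: existence, independence of choices, comparison. -/

section Oscillation

variable {n : ℕ} {a b : ℝ}

/-- The point of `[t k, t (k + 1)]` closest to `s`. -/
def clampTo (t : ℕ → ℝ) (k : ℕ) (s : ℝ) : ℝ := max (t k) (min s (t (k + 1)))

/-- Telescoping: intervals left of `s` contribute full increments, the one containing `s` a partial
one, later ones nothing. -/
theorem sum_clampTo (h : ℝ → ℤ) (t : ℕ → ℝ) (p : ℕ) (ht : ∀ k < p, t k ≤ t (k + 1)) (s : ℝ)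
    (hs : t 0 ≤ s) :
    ∑ k ∈ Finset.range p, (h (clampTo t k s) - h (t k)) = h (min s (t p)) - h (t 0) := by
  induction p with
  | zero => simp [hs]
  | succ p ih =>
    rw [Finset.sum_range_succ, ih fun k hk => ht k (by omega)]
    have hp := ht p (by omega)
    rcases le_total (t p) s with h1 | h1
    · rw [clampTo, max_eq_right (le_min h1 hp), min_eq_right h1]
      ring
    · rw [clampTo, min_eq_left (h1.trans hp), max_eq_left h1, min_eq_left h1]
      ring

/-- A path of comparative indices whose increment over `[a, b]` is `oscSum`. -/
noncomputable def oscPrim (Y : ℝ → Matrix (Fin n ⊕ Fin n) (Fin n) ℝ) (p : ℕ) (t : ℕ → ℝ)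
    (R : ℕ → ℝ → Matrix (Fin n ⊕ Fin n) (Fin n ⊕ Fin n) ℝ) (s : ℝ) : ℤ :=
  ∑ k ∈ Finset.range p,
    (compIndex (Y (clampTo t k s)) (R k (clampTo t k s) * vertE n) : ℤ)

variable {Y : ℝ → Matrix (Fin n ⊕ Fin n) (Fin n) ℝ} {p : ℕ} {t : ℕ → ℝ}
  {R : ℕ → ℝ → Matrix (Fin n ⊕ Fin n) (Fin n ⊕ Fin n) ℝ}

namespace IsAdmissible

theorem monotoneOn (h : IsAdmissible a b Y p t R) {j k : ℕ} (hjk : j ≤ k) (hk : k ≤ p) :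
    t j ≤ t k := by
  induction k, hjk using Nat.le_induction with
  | base => exact le_rfl
  | succ k hjk ih => exact (ih (by omega)).trans (h.lt_succ k (by omega)).le

theorem mem_Icc (h : IsAdmissible a b Y p t R) {k : ℕ} (hk : k ≤ p) : t k ∈ Icc a b := by
  rw [← h.first, ← h.last]
  exact ⟨h.monotoneOn (Nat.zero_le k) hk, h.monotoneOn hk le_rfl⟩

theorem Icc_subset (h : IsAdmissible a b Y p t R) {k : ℕ} (hk : k < p) :
    Icc (t k) (t (k + 1)) ⊆ Icc a b :=
  Icc_subset_Icc (h.mem_Icc hk.le).1 (h.mem_Icc (Nat.succ_le_of_lt hk)).2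

theorem oscPrim_sub (h : IsAdmissible a b Y p t R) :
    oscPrim Y p t R b - oscPrim Y p t R a = oscSum Y p t R := by
  rw [oscPrim, oscPrim, oscSum, ← Finset.sum_sub_distrib]
  refine Finset.sum_congr rfl fun k hk => ?_
  rw [Finset.mem_range] at hk
  have h1 := h.mem_Icc hk.le
  have h2 := h.mem_Icc (Nat.succ_le_of_lt hk)
  have h3 := (h.lt_succ k hk).le
  have e1 : clampTo t k b = t (k + 1) := by rw [clampTo, min_eq_right h2.2, max_eq_right h3]
  have e2 : clampTo t k a = t k := by
    rw [clampTo, max_eq_left ((min_le_left _ _).trans h1.1)]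
  rw [e1, e2]

end IsAdmissible

theorem clampTo_mem (t : ℕ → ℝ) (k : ℕ) (s : ℝ) (h : t k ≤ t (k + 1)) :
    clampTo t k s ∈ Icc (t k) (t (k + 1)) :=
  ⟨le_max_left _ _, max_le h (min_le_right _ _)⟩

theorem continuous_clampTo (t : ℕ → ℝ) (k : ℕ) : Continuous (clampTo t k) := by
  unfold clampTo
  fun_prop

open Filter Topology

/-- The system `R` leaves no trace. Where the clamped point moves, constancy of `rank W(R k E, Y)`
fixes `μ + ind σ_Y - ind σ_R`, and constancy of the rank of the upper block of `R k E` fixes `ind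
σ_R`. -/
theorem eventually_oscPrim_add_idx_chart (h : IsAdmissible a b Y p t R)
    (hYc : ContinuousOn Y (Icc a b)) (hYL : ∀ s ∈ Icc a b, IsLagrangianPlane (Y s)) {s₀ : ℝ}
    (hs₀ : s₀ ∈ Icc a b) {c : ℝ} (hK : IsUnit (chartDen c (Y s₀)).det)
    (hKR : ∀ k < p, IsUnit (chartDen c (R k s₀ * vertE n)).det) :
    ∀ᶠ s in 𝓝[Icc a b] s₀, oscPrim Y p t R s + idx (chart c (Y s)) =
      oscPrim Y p t R s₀ + idx (chart c (Y s₀)) := by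
  have key : ∀ k ∈ Finset.range p, ∀ᶠ s in 𝓝[Icc a b] s₀,
      (compIndex (Y (clampTo t k s)) (R k (clampTo t k s) * vertE n) : ℤ)
        + idx (chart c (Y (clampTo t k s))) =
      compIndex (Y (clampTo t k s₀)) (R k (clampTo t k s₀) * vertE n)
        + idx (chart c (Y (clampTo t k s₀))) := by
    intro k hk
    rw [Finset.mem_range] at hk
    have hlt := h.lt_succ k hk
    by_cases h1 : s₀ < t k
    · filter_upwards [mem_nhdsWithin_of_mem_nhds (Iio_mem_nhds h1)] with s hs
      have e : ∀ x < t k, clampTo t k x = t k := fun x hx => by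
        rw [clampTo, max_eq_left ((min_le_left _ _).trans hx.le)]
      rw [e s hs, e s₀ h1]
    by_cases h2 : t (k + 1) < s₀
    · filter_upwards [mem_nhdsWithin_of_mem_nhds (Ioi_mem_nhds h2)] with s hs
      have e : ∀ x > t (k + 1), clampTo t k x = t (k + 1) := fun x hx => by
        rw [clampTo, min_eq_right hx.le, max_eq_right hlt.le]
      rw [e s hs, e s₀ h2]
    push Not at h1 h2
    have hmem : s₀ ∈ Icc (t k) (t (k + 1)) := ⟨h1, h2⟩
    have e : clampTo t k s₀ = s₀ := by rw [clampTo, min_eq_left h2, max_eq_right h1]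
    have hcl : Tendsto (clampTo t k) (𝓝[Icc a b] s₀) (𝓝[Icc (t k) (t (k + 1))] s₀) := by
      refine tendsto_nhdsWithin_iff.2 ⟨?_, .of_forall fun s => clampTo_mem t k s hlt.le⟩
      have := (continuous_clampTo t k).tendsto s₀
      rw [e] at this
      exact this.mono_left nhdsWithin_le_nhds
    rw [e]
    have hsub := h.Icc_subset hk
    obtain ⟨ρ, hρ⟩ := h.rank_wronskian k hk
    obtain ⟨ρ', hρ'⟩ := h.rank_upper k hk
    have hRL : ∀ s ∈ Icc a b, IsLagrangianPlane (R k s * vertE n) := fun s hs =>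
      isLagrangianPlane_vertE.symplectic_mul (h.symplectic k hk s hs)
    have hYt : Tendsto Y (𝓝[Icc (t k) (t (k + 1))] s₀) (𝓝 (Y s₀)) := (hYc.mono hsub) s₀ hmem
    have hRt : Tendsto (fun s => R k s * vertE n) (𝓝[Icc (t k) (t (k + 1))] s₀)
        (𝓝 (R k s₀ * vertE n)) :=
      (Continuous.tendsto (continuous_id.matrix_mul continuous_const) (R k s₀)).comp
        (h.continuousOn k hk s₀ hmem)
    have hYw : ∀ᶠ s in 𝓝[Icc (t k) (t (k + 1))] s₀, wronskian (Y s) (Y s) = 0 := by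
      filter_upwards [self_mem_nhdsWithin] with s hs using (hYL s (hsub hs)).1
    have hRw : ∀ᶠ s in 𝓝[Icc (t k) (t (k + 1))] s₀,
        wronskian (R k s * vertE n) (R k s * vertE n) = 0 := by
      filter_upwards [self_mem_nhdsWithin] with s hs using (hRL s (hsub hs)).1
    refine hcl.eventually (p := fun s => (compIndex (Y s) (R k s * vertE n) : ℤ) +
      idx (chart c (Y s)) = compIndex (Y s₀) (R k s₀ * vertE n) + idx (chart c (Y s₀))) ?_
    filter_upwards [eventually_compIndex_add_idx_chart hYt hRt (hYL s₀ hs₀).1 (hRL s₀ hs₀).1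
        hYw hRw hK (hKR k hk) (by
          filter_upwards [self_mem_nhdsWithin] with s hs
          rw [rank_wronskian_comm, hρ s hs, rank_wronskian_comm, hρ s₀ hmem]),
      eventually_idx_chart_eq hRt (hRL s₀ hs₀).1 hRw (hKR k hk) (by
          filter_upwards [self_mem_nhdsWithin] with s hs
          rw [hρ' s hs, hρ' s₀ hmem])] with s h3 h4
    omega
  -- Spreads the single term `ind σ_Y` over the partition, so that the claim can be checked interval
  -- by interval.
  have htel : ∀ s ∈ Icc a b, (idx (chart c (Y s)) : ℤ) = (idx (chart c (Y (t 0))) : ℤ) +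
      ∑ k ∈ Finset.range p,
        ((idx (chart c (Y (clampTo t k s))) : ℤ) - idx (chart c (Y (t k)))) := by
    intro s hs
    rw [sum_clampTo (fun s => (idx (chart c (Y s)) : ℤ)) t p (fun k hk => (h.lt_succ k hk).le) s
      (by rw [h.first]; exact hs.1), h.last, min_eq_left hs.2]
    ring
  filter_upwards [(Filter.eventually_all_finset _).2 key, self_mem_nhdsWithin] with s h1 hs
  rw [htel s hs, htel s₀ hs₀, oscPrim, oscPrim]
  rw [add_left_comm, ← Finset.sum_add_distrib, add_left_comm (Finset.sum _ _),
    ← Finset.sum_add_distrib]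
  congr 1
  refine Finset.sum_congr rfl fun k hk => ?_
  have := h1 k hk
  omega

theorem eq_of_eventually_eq {f : ℝ → ℤ} (hab : a ≤ b)
    (h : ∀ s ∈ Icc a b, ∀ᶠ x in 𝓝[Icc a b] s, f x = f s) : f a = f b := by
  refine isPreconnected_Icc.constant (f := f) (fun s hs => ?_) (left_mem_Icc.2 hab)
    (right_mem_Icc.2 hab)
  exact tendsto_const_nhds.congr' ((h s hs).mono fun x hx => hx.symm)

/-- Comparison of two Lagrangian paths whose Wronskian has constant rank. -/
theorem oscSum_sub_oscSum {A : ℝ → Matrix (Fin n ⊕ Fin n) (Fin n) ℝ} {p' : ℕ} {t' : ℕ → ℝ}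
    {R' : ℕ → ℝ → Matrix (Fin n ⊕ Fin n) (Fin n ⊕ Fin n) ℝ} (hab : a ≤ b)
    (hY : IsAdmissible a b Y p t R) (hA : IsAdmissible a b A p' t' R')
    (hYc : ContinuousOn Y (Icc a b)) (hAc : ContinuousOn A (Icc a b))
    (hYL : ∀ s ∈ Icc a b, IsLagrangianPlane (Y s)) (hAL : ∀ s ∈ Icc a b, IsLagrangianPlane (A s))
    (hr : ∀ s ∈ Icc a b, ∀ x ∈ Icc a b,
      (wronskian (Y s) (A s)).rank = (wronskian (Y x) (A x)).rank) :
    oscSum Y p t R - oscSum A p' t' R' =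
      (compIndex (Y b) (A b) : ℤ) - compIndex (Y a) (A a) := by
  -- This difference is locally constant: in one chart containing all the planes at `s`, the terms
  -- `ind σ_Y` and `ind σ_A` cancel.
  have h := eq_of_eventually_eq hab (f := fun s => oscPrim Y p t R s - oscPrim A p' t' R' s -
    compIndex (Y s) (A s)) (fun s hs => by
      obtain ⟨c, hc⟩ := exists_forall_isUnit_chartDen
        (s := {Y s, A s} ∪ ((fun k => R k s * vertE n) '' Iio p) ∪
          ((fun k => R' k s * vertE n) '' Iio p'))
        ((((finite_singleton _).insert _).union ((finite_Iio p).image _)).union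
          ((finite_Iio p').image _)) (by
        rintro B ((hB | ⟨k, hk, rfl⟩) | ⟨k, hk, rfl⟩)
        · rcases hB with rfl | rfl
          exacts [hYL s hs, hAL s hs]
        · exact isLagrangianPlane_vertE.symplectic_mul (hY.symplectic k hk s hs)
        · exact isLagrangianPlane_vertE.symplectic_mul (hA.symplectic k hk s hs))
      have hKY := hc (Y s) (by simp)
      have hKA := hc (A s) (by simp)
      filter_upwards [eventually_oscPrim_add_idx_chart hY hYc hYL hs hKY
          (fun k hk => hc _ (.inl (.inr ⟨k, hk, rfl⟩))),
        eventually_oscPrim_add_idx_chart hA hAc hAL hs hKA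
          (fun k hk => hc _ (.inr ⟨k, hk, rfl⟩)),
        eventually_compIndex_add_idx_chart (hYc s hs) (hAc s hs) (hYL s hs).1 (hAL s hs).1
          (by filter_upwards [self_mem_nhdsWithin] with x hx using (hYL x hx).1)
          (by filter_upwards [self_mem_nhdsWithin] with x hx using (hAL x hx).1) hKY hKA
          (by filter_upwards [self_mem_nhdsWithin] with x hx using hr x hx s hs)] with x h1 h2 h3
      omega)
  have h1 := hY.oscPrim_sub
  have h2 := hA.oscPrim_sub
  omega

theorem compIndex_self {Y : Matrix (Fin n ⊕ Fin n) (Fin n) ℝ} (hY : IsLagrangianPlane Y) :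
    compIndex Y Y = 0 := by
  obtain ⟨c, hc⟩ := exists_forall_isUnit_chartDen (s := {Y}) (by simp) (by simp [hY])
  have h := compIndex_add_idx_chart hY.1 hY.1 (hc Y rfl) (hc Y rfl)
  have h0 := idx_add_idx_neg (0 : Matrix (Fin n) (Fin n) ℝ) (by simp)
  rw [rank_zero] at h0
  rw [sub_self] at h
  omega

theorem oscSum_eq_oscSum {p' : ℕ} {t' : ℕ → ℝ}
    {R' : ℕ → ℝ → Matrix (Fin n ⊕ Fin n) (Fin n ⊕ Fin n) ℝ} (hab : a ≤ b)
    (h : IsAdmissible a b Y p t R) (h' : IsAdmissible a b Y p' t' R')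
    (hYc : ContinuousOn Y (Icc a b)) (hYL : ∀ s ∈ Icc a b, IsLagrangianPlane (Y s)) :
    oscSum Y p t R = oscSum Y p' t' R' := by
  have := oscSum_sub_oscSum hab h h' hYc hYc hYL hYL fun s hs x hx => by
    rw [show wronskian (Y s) (Y s) = 0 from (hYL s hs).1,
      show wronskian (Y x) (Y x) = 0 from (hYL x hx).1]
  rw [compIndex_self (hYL b (right_mem_Icc.2 hab)), compIndex_self (hYL a (left_mem_Icc.2 hab))]
    at this
  omega

/-- On each interval `μ + μ* + rank X` is constant, since the ranks attached to `R k` are; the ranks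
of `X` at the partition points telescope. -/
theorem dualOscSum_eq (h : IsAdmissible a b Y p t R)
    (hYL : ∀ s ∈ Icc a b, IsLagrangianPlane (Y s)) :
    dualOscSum Y p t R = oscSum Y p t R + (Y b).toRows₁.rank - (Y a).toRows₁.rank := by
  have htel := Finset.sum_range_sub (fun k => ((Y (t k)).toRows₁.rank : ℤ)) p
  rw [h.first, h.last] at htel
  rw [add_sub_assoc, ← htel, oscSum, dualOscSum, ← Finset.sum_add_distrib]
  refine Finset.sum_congr rfl fun k hk => ?_
  rw [Finset.mem_range] at hk
  have hlt := (h.lt_succ k hk).le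
  have hRL : ∀ s ∈ Icc a b, IsLagrangianPlane (R k s * vertE n) := fun s hs =>
    isLagrangianPlane_vertE.symplectic_mul (h.symplectic k hk s hs)
  have m1 := h.mem_Icc hk.le
  have m2 := h.mem_Icc (Nat.succ_le_of_lt hk)
  have e1 := compIndex_add_dualCompIndex (hYL _ m1) (hRL _ m1)
  have e2 := compIndex_add_dualCompIndex (hYL _ m2) (hRL _ m2)
  obtain ⟨ρ, hρ⟩ := h.rank_wronskian k hk
  obtain ⟨ρ', hρ'⟩ := h.rank_upper k hk
  rw [rank_wronskian_comm, hρ _ ⟨le_rfl, hlt⟩, hρ' _ ⟨le_rfl, hlt⟩] at e1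
  rw [rank_wronskian_comm, hρ _ ⟨hlt, le_rfl⟩, hρ' _ ⟨hlt, le_rfl⟩] at e2
  simp only [Nat.succ_eq_add_one] at *
  omega

theorem exists_uniform_partition (hab : a < b) {U : ℝ → Set ℝ}
    (hU : ∀ x ∈ Icc a b, U x ∈ 𝓝[Icc a b] x) :
    ∃ (p : ℕ) (t : ℕ → ℝ), t 0 = a ∧ t p = b ∧ (∀ k < p, t k < t (k + 1)) ∧
      ∀ k < p, ∃ x ∈ Icc a b, Icc (t k) (t (k + 1)) ⊆ U x := by
  obtain ⟨δ, hδ, h⟩ := Metric.uniformity_basis_dist.lebesgue_number_lemma_nhdsWithin'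
    (U := fun x _ => U x) isCompact_Icc hU
  obtain ⟨N, hN⟩ := exists_nat_gt ((b - a) / δ)
  have hba : 0 < b - a := sub_pos.2 hab
  have hN0 : (0 : ℝ) < N := (div_pos hba hδ).trans hN
  have hstep : (b - a) / N < δ := by
    rw [div_lt_iff₀ hδ] at hN
    rw [div_lt_iff₀ hN0]
    linarith
  have hpos : 0 < (b - a) / N := div_pos hba hN0
  have hb : a + N * ((b - a) / N) = b := by
    field_simp
    ring
  refine ⟨N, fun k => a + k * ((b - a) / N), by simp, hb, fun k _ => ?_, fun k hk => ?_⟩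
  · push_cast
    linarith
  · have hk' : ((k : ℝ) + 1) * ((b - a) / N) ≤ N * ((b - a) / N) := by
      gcongr
      exact_mod_cast hk
    have hk0 : 0 ≤ (k : ℝ) * ((b - a) / N) := by positivity
    obtain ⟨y, hy⟩ := h (a + k * ((b - a) / N)) ⟨by linarith, by linarith⟩
    refine ⟨y, y.2, fun s hs => hy ⟨?_, ?_⟩⟩
    · push_cast at hs
      change dist _ s < δ
      rw [dist_comm, Real.dist_eq, abs_of_nonneg (by linarith [hs.1])]
      linarith [hs.2]
    · push_cast at hs
      exact ⟨by linarith [hs.1], by linarith [hs.2]⟩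

/-- The symplectic matrix `(0 I; -I c I)`. -/
def chartSymplectic (n : ℕ) (c : ℝ) : Matrix (Fin n ⊕ Fin n) (Fin n ⊕ Fin n) ℝ :=
  fromBlocks 0 1 (-1) (c • 1)

theorem chartSymplectic_mem (n : ℕ) (c : ℝ) :
    chartSymplectic n c ∈ Matrix.symplecticGroup (Fin n) ℝ := by
  rw [mem_symplecticGroup_iff_skewJ]
  simp [chartSymplectic, skewJ, fromBlocks_transpose, fromBlocks_multiply]

theorem chartSymplectic_mul_vertE (n : ℕ) (c : ℝ) :
    chartSymplectic n c * vertE n = fromRows 1 (c • 1) := by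
  rw [chartSymplectic, vertE, fromBlocks_mul_fromRows]
  simp

/-- Constant `R k` suffice: with `R k E = (I; c I)` the Wronskian is `U - c X`, invertible near each
point for a suitable `c`. A Lebesgue number argument makes the partition fine enough. -/
theorem exists_isAdmissible (hab : a < b) (hYc : ContinuousOn Y (Icc a b))
    (hYL : ∀ s ∈ Icc a b, IsLagrangianPlane (Y s)) : ∃ p t R, IsAdmissible a b Y p t R := by
  have h0 : ∀ x : Icc a b, ∃ c : ℝ, IsUnit (chartDen c (Y x)).det := fun x => by
    obtain ⟨c, hc⟩ := exists_forall_isUnit_chartDen (s := {Y x}) (by simp) (by simp [hYL x x.2])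
    exact ⟨c, hc _ rfl⟩
  have h1 : ∀ x : ℝ, ∃ c : ℝ, x ∈ Icc a b → IsUnit (chartDen c (Y x)).det := fun x => by
    by_cases hx : x ∈ Icc a b
    · obtain ⟨c, hc⟩ := h0 ⟨x, hx⟩
      exact ⟨c, fun _ => hc⟩
    · exact ⟨0, fun h => absurd h hx⟩
  choose c hc using h1
  obtain ⟨p, t, ht0, htp, hlt, hU⟩ := exists_uniform_partition hab
    (U := fun x => {s | IsUnit (chartDen (c x) (Y s)).det})
    (fun x hx => (hYc x hx).eventually (eventually_isUnit_chartDen (hc x hx)))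
  choose! x hx hxU using hU
  refine ⟨p, t, fun k _ => chartSymplectic n (c (x k)), ht0, htp, hlt,
    fun k _ s _ => chartSymplectic_mem n _, fun k _ => continuousOn_const,
    fun k hk => ⟨n, fun s hs => ?_⟩, fun k _ => ⟨n, fun s _ => ?_⟩⟩
  · have hu : IsUnit (chartDen (c (x k)) (Y s)).det := hxU k hk hs
    have e : wronskian (chartSymplectic n (c (x k)) * vertE n) (Y s) =
        chartDen (c (x k)) (Y s) := by
      rw [chartSymplectic_mul_vertE, wronskian_eq, chartDen]
      simp
    rw [e, rank_of_isUnit _ ((Matrix.isUnit_iff_isUnit_det _).2 hu), Fintype.card_fin]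
  · rw [chartSymplectic_mul_vertE, toRows₁_fromRows, rank_one, Fintype.card_fin]

theorem isOscNumber_oscNumber (hab : a < b) (hYc : ContinuousOn Y (Icc a b))
    (hYL : ∀ s ∈ Icc a b, IsLagrangianPlane (Y s)) : IsOscNumber a b Y (oscNumber a b Y) := by
  obtain ⟨p, t, R, h⟩ := exists_isAdmissible hab hYc hYL
  exact Classical.epsilon_spec (p := IsOscNumber a b Y) ⟨oscSum Y p t R, ⟨p, t, R, h⟩,
    fun p' t' R' h' => oscSum_eq_oscSum hab.le h' h hYc hYL⟩

theorem isDualOscNumber_dualOscNumber (hab : a < b) (hYc : ContinuousOn Y (Icc a b))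
    (hYL : ∀ s ∈ Icc a b, IsLagrangianPlane (Y s)) :
    IsDualOscNumber a b Y (dualOscNumber a b Y) := by
  obtain ⟨p, t, R, h⟩ := exists_isAdmissible hab hYc hYL
  refine Classical.epsilon_spec (p := IsDualOscNumber a b Y) ⟨dualOscSum Y p t R, ⟨p, t, R, h⟩,
    fun p' t' R' h' => ?_⟩
  rw [dualOscSum_eq h' hYL, dualOscSum_eq h hYL, oscSum_eq_oscSum hab.le h' h hYc hYL]

theorem dualOscNumber_eq (hab : a < b) (hYc : ContinuousOn Y (Icc a b))
    (hYL : ∀ s ∈ Icc a b, IsLagrangianPlane (Y s)) :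
    dualOscNumber a b Y = oscNumber a b Y + (Y b).toRows₁.rank - (Y a).toRows₁.rank := by
  obtain ⟨p, t, R, h⟩ := exists_isAdmissible hab hYc hYL
  rw [← (isOscNumber_oscNumber hab hYc hYL).2 p t R h,
    ← (isDualOscNumber_dualOscNumber hab hYc hYL).2 p t R h, dualOscSum_eq h hYL]

theorem oscNumber_sub_oscNumber {A : ℝ → Matrix (Fin n ⊕ Fin n) (Fin n) ℝ} (hab : a < b)
    (hYc : ContinuousOn Y (Icc a b)) (hAc : ContinuousOn A (Icc a b))
    (hYL : ∀ s ∈ Icc a b, IsLagrangianPlane (Y s)) (hAL : ∀ s ∈ Icc a b, IsLagrangianPlane (A s))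
    (hr : ∀ s ∈ Icc a b, ∀ x ∈ Icc a b,
      (wronskian (Y s) (A s)).rank = (wronskian (Y x) (A x)).rank) :
    oscNumber a b Y - oscNumber a b A = (compIndex (Y b) (A b) : ℤ) - compIndex (Y a) (A a) := by
  obtain ⟨p, t, R, h⟩ := exists_isAdmissible hab hYc hYL
  obtain ⟨p', t', R', h'⟩ := exists_isAdmissible hab hAc hAL
  rw [← (isOscNumber_oscNumber hab hYc hYL).2 p t R h,
    ← (isOscNumber_oscNumber hab hAc hAL).2 p' t' R' h',
    oscSum_sub_oscSum hab.le h h' hYc hAc hYL hAL hr]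

end Oscillation

/-! ### Prescribing comparative indices, and the family generated by `Φ`. -/

section Family

variable {n : ℕ} {a b : ℝ}

theorem pinv_one : pinv (1 : Matrix (Fin n) (Fin n) ℝ) = 1 := by
  simpa using (pinv_spec (1 : Matrix (Fin n) (Fin n) ℝ)).mul_mul_left

theorem compM_fromRows_one (Q : Matrix (Fin n) (Fin n) ℝ)
    (A : Matrix (Fin n ⊕ Fin n) (Fin n) ℝ) : compM (fromRows 1 Q) A = 0 := by
  simp [compM, pinv_one]

theorem compP_fromRows_one (Q : Matrix (Fin n) (Fin n) ℝ)
    (A : Matrix (Fin n ⊕ Fin n) (Fin n) ℝ) :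
    compP (fromRows 1 Q) A = (wronskian (fromRows 1 Q) A)ᵀ * A.toRows₁ := by
  simp [compP, compV, compM_fromRows_one, pinv_one]

/-- The comparative indices with a given Lagrangian plane take every pair of values allowed by
the rank of its upper block, on graphs of symmetric matrices. -/
theorem exists_compIndex_eq {A : Matrix (Fin n ⊕ Fin n) (Fin n) ℝ} (hA : IsLagrangianPlane A)
    {k m : ℕ} (hkm : k + m ≤ A.toRows₁.rank) :
    ∃ Q : Matrix (Fin n) (Fin n) ℝ, Qᵀ = Q ∧ compIndex (fromRows 1 Q) A = k ∧
      dualCompIndex (fromRows 1 Q) A = m := by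
  obtain ⟨c, hc⟩ := exists_forall_isUnit_chartDen (s := {A}) (by simp) (by simp [hA])
  have hK := hc A rfl
  have hτ := transpose_chart hA.1 hK
  have hτK := chart_mul_chartDen hK
  obtain ⟨O, d, hO, hO', hd⟩ := exists_orthogonal_diagonalization _ hτ
  have hrank : A.toRows₁.rank = (Finset.univ.filter fun i => d i ≠ 0).card := by
    rw [← rank_chart hK, hd,
      rank_mul_eq_left_of_isUnit_det _ _ (isUnit_det_of_mul_eq_one' _ _ hO),
      rank_mul_eq_right_of_isUnit_det _ _ (isUnit_det_of_mul_eq_one' _ _ hO'), rank_diagonal,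
      Fintype.card_subtype]
  rw [hrank] at hkm
  obtain ⟨P, hP, hPk⟩ := Finset.exists_subset_card_eq ((Nat.le_add_right k m).trans hkm)
  obtain ⟨N, hN, hNm⟩ := Finset.exists_subset_card_eq
    (show m ≤ ((Finset.univ.filter fun i => d i ≠ 0) \ P).card by
      rw [Finset.card_sdiff_of_subset hP]; omega)
  -- Target signs: `compP` will be congruent to `diag e`, with `k` entries `-1` and `m` entries `1`,
  -- all placed where `d` is nonzero.
  set e : Fin n → ℝ := fun i => if i ∈ P then -1 else if i ∈ N then 1 else 0 with he
  -- Solves `d + d q d = e`; where `d i = 0` both sides vanish. For `Q = c - O diag(q) Oᵀ`, `compP`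
  -- is congruent to `τ + τ (c - Q) τ`, with `τ` the chart coordinate of `A`.
  set q : Fin n → ℝ := fun i => (e i - d i) / (d i * d i) with hq
  have hdq : ∀ i, d i + d i * q i * d i = e i := by
    intro i
    by_cases h0 : d i = 0
    · have h1 : i ∉ P := fun h => by simpa [h0] using hP h
      have h2 : i ∉ N := fun h => by simpa [h0] using hN h
      simp [h0, he, h1, h2]
    · simp only [hq]
      field_simp
      ring
  have hQt : (c • 1 - O * diagonal q * Oᵀ)ᵀ = c • 1 - O * diagonal q * Oᵀ := by
    simp [transpose_mul, Matrix.mul_assoc]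
  have hP' : compP (fromRows 1 (c • 1 - O * diagonal q * Oᵀ)) A =
      (chartDen c A)ᵀ * (O * diagonal e * Oᵀ) * chartDen c A := by
    have h1 : O * diagonal e * Oᵀ = chart c A + chart c A * (O * diagonal q * Oᵀ) * chart c A := by
      have : diagonal e = diagonal d + diagonal d * diagonal q * diagonal d := by
        rw [diagonal_mul_diagonal, diagonal_mul_diagonal, diagonal_add]
        exact congrArg _ (funext fun i => (hdq i).symm)
      rw [this, hd, Matrix.mul_add, Matrix.add_mul]
      congr 1
      calc O * (diagonal d * diagonal q * diagonal d) * Oᵀ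
          = O * diagonal d * 1 * diagonal q * 1 * diagonal d * Oᵀ := by
            simp only [Matrix.mul_assoc, Matrix.one_mul]
        _ = _ := by rw [← hO]; simp only [Matrix.mul_assoc]
    have h2 : chartDen c (fromRows 1 (c • 1 - O * diagonal q * Oᵀ)) = -(O * diagonal q * Oᵀ) := by
      simp [chartDen]
    have h3 : A.toRows₁ᵀ = (chartDen c A)ᵀ * chart c A := by
      rw [← hτK, transpose_mul, hτ]
    have h4 : (O * diagonal q * Oᵀ)ᵀ = O * diagonal q * Oᵀ := by
      simp [transpose_mul, Matrix.mul_assoc]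
    rw [compP_fromRows_one, wronskian_eq_chartDen c, h2, toRows₁_fromRows, transpose_one,
      Matrix.one_mul, h1, transpose_neg, h4, Matrix.neg_mul, sub_neg_eq_add, transpose_add,
      transpose_mul, h4, h3, Matrix.add_mul, ← hτK]
    simp only [Matrix.mul_add, Matrix.add_mul, Matrix.mul_assoc]
  have hsymm : (O * diagonal e * Oᵀ)ᵀ = O * diagonal e * Oᵀ := by
    simp [transpose_mul, Matrix.mul_assoc]
  have hneg : -(O * diagonal e * Oᵀ) = O * diagonal (-e) * Oᵀ := by
    rw [show diagonal (-e) = -diagonal e from (diagonal_neg e).symm, Matrix.mul_neg,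
      Matrix.neg_mul]
  refine ⟨c • 1 - O * diagonal q * Oᵀ, hQt, ?_, ?_⟩
  · rw [compIndex, compM_fromRows_one, rank_zero, zero_add, hP', negIndex_eq_idx,
      idx_congr _ _ hsymm hK, idx_orthogonal_conj _ _ hO, idx_diagonal]
    have : {i | e i < 0} = (P : Set (Fin n)) := by
      ext i
      simp only [he, mem_ofPred_eq, Finset.mem_coe]
      split_ifs <;> norm_num <;> assumption
    rw [this, Set.ncard_coe_finset, hPk]
  · rw [dualCompIndex, compM_fromRows_one, rank_zero, zero_add, hP', negIndex_eq_idx,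
      ← Matrix.neg_mul, ← Matrix.mul_neg,
      idx_congr _ _ (by rw [transpose_neg, hsymm]) hK, hneg, idx_orthogonal_conj _ _ hO,
      idx_diagonal]
    have : {i | (-e) i < 0} = (N : Set (Fin n)) := by
      ext i
      have hdisj : i ∈ N → i ∉ P := fun h => (Finset.mem_sdiff.1 (hN h)).2
      simp only [he, mem_ofPred_eq, Finset.mem_coe, Pi.neg_apply]
      split_ifs with h1 h2
      · simp only [neg_neg]
        exact ⟨fun h => absurd h (by norm_num), fun h => absurd h1 (hdisj h)⟩
      · simp [h2]
      · simp [h2]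
    rw [this, Set.ncard_coe_finset, hNm]

/-- The plane `E` has coordinate `0` in every chart, so both sides of the chart identity contain the
same `ind σ_Y`. -/
theorem compIndex_vertE {Y : Matrix (Fin n ⊕ Fin n) (Fin n) ℝ} (hY : IsLagrangianPlane Y) :
    compIndex Y (vertE n) = 0 := by
  obtain ⟨c, hc⟩ := exists_forall_isUnit_chartDen (s := {Y, vertE n}) (by simp)
    (by simp [hY, isLagrangianPlane_vertE])
  have h := compIndex_add_idx_chart hY.1 isLagrangianPlane_vertE.1 (hc Y (by simp))
    (hc _ (by simp))
  have h0 := idx_add_idx_neg (0 : Matrix (Fin n) (Fin n) ℝ) (by simp)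
  have h1 : chart c (vertE n) = 0 := by simp [chart, vertE]
  rw [rank_zero] at h0
  rw [h1, sub_zero] at h
  omega

theorem rank_wronskian_vertE (Y : Matrix (Fin n ⊕ Fin n) (Fin n) ℝ) :
    (wronskian Y (vertE n)).rank = Y.toRows₁.rank := by
  rw [← rank_transpose Y.toRows₁, wronskian_eq]
  simp [vertE]

theorem isUnit_of_rank_eq (M : Matrix (Fin n) (Fin n) ℝ) (h : M.rank = n) : IsUnit M := by
  have h7 := LinearMap.finrank_range_add_finrank_ker M.mulVecLin
  have h8 : Module.finrank ℝ (LinearMap.range M.mulVecLin) = n := h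
  rw [h8, Module.finrank_fin_fun] at h7
  have h9 : LinearMap.ker M.mulVecLin = ⊥ := Submodule.finrank_eq_zero.1 (by omega)
  exact mulVec_injective_iff_isUnit.1 (LinearMap.ker_eq_bot.1 h9)

variable {Φ : ℝ → Matrix (Fin n ⊕ Fin n) (Fin n ⊕ Fin n) ℝ}
  {Y A : ℝ → Matrix (Fin n ⊕ Fin n) (Fin n) ℝ}

/-- Membership in the family in terms of matrix multiplication; in the definition, the product is
elaborated through the type synonym `CStarMatrix`. -/
theorem exists_eq_mul_of_mem_lagrangianFamily (hY : Y ∈ lagrangianFamily a b Φ) :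
    ∃ C : Matrix (Fin n ⊕ Fin n) (Fin n) ℝ, IsLagrangianPlane C ∧ ∀ s ∈ Icc a b,
      Y s = HMul.hMul (self := Matrix.instHMulOfFintypeOfMulOfAddCommMonoid) (Φ s) C :=
  hY

theorem continuousOn_of_mem_lagrangianFamily (hΦc : ContinuousOn Φ (Icc a b))
    (hY : Y ∈ lagrangianFamily a b Φ) : ContinuousOn Y (Icc a b) := by
  obtain ⟨C, -, hC⟩ := exists_eq_mul_of_mem_lagrangianFamily hY
  exact ((continuous_id.matrix_mul continuous_const).comp_continuousOn hΦc).congr hC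

theorem isLagrangianPlane_of_mem_lagrangianFamily
    (hΦs : ∀ s ∈ Icc a b, Φ s ∈ Matrix.symplecticGroup (Fin n) ℝ)
    (hY : Y ∈ lagrangianFamily a b Φ) : ∀ s ∈ Icc a b, IsLagrangianPlane (Y s) := by
  obtain ⟨C, hC, hYC⟩ := exists_eq_mul_of_mem_lagrangianFamily hY
  intro s hs
  rw [hYC s hs]
  exact hC.symplectic_mul (hΦs s hs)

theorem wronskian_eq_of_mem_lagrangianFamily
    (hΦs : ∀ s ∈ Icc a b, Φ s ∈ Matrix.symplecticGroup (Fin n) ℝ)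
    (hY : Y ∈ lagrangianFamily a b Φ) (hA : A ∈ lagrangianFamily a b Φ) :
    ∀ s ∈ Icc a b, ∀ x ∈ Icc a b, wronskian (Y s) (A s) = wronskian (Y x) (A x) := by
  obtain ⟨C, -, hC⟩ := exists_eq_mul_of_mem_lagrangianFamily hY
  obtain ⟨D, -, hD⟩ := exists_eq_mul_of_mem_lagrangianFamily hA
  intro s hs x hx
  rw [hC s hs, hD s hs, hC x hx, hD x hx, wronskian_symplectic (hΦs s hs),
    wronskian_symplectic (hΦs x hx)]

theorem exists_mem_lagrangianFamily
    (hΦs : ∀ s ∈ Icc a b, Φ s ∈ Matrix.symplecticGroup (Fin n) ℝ) {s₀ : ℝ} (hs₀ : s₀ ∈ Icc a b)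
    {D : Matrix (Fin n ⊕ Fin n) (Fin n) ℝ} (hD : IsLagrangianPlane D) :
    ∃ Y ∈ lagrangianFamily a b Φ, Y s₀ = D := by
  set g : Matrix.symplecticGroup (Fin n) ℝ := ⟨Φ s₀, hΦs s₀ hs₀⟩ with hg
  have h : Φ s₀ * (g⁻¹ : Matrix.symplecticGroup (Fin n) ℝ).1 = 1 :=
    congrArg Subtype.val (mul_inv_cancel g)
  refine ⟨fun s => Φ s * ((g⁻¹ : Matrix.symplecticGroup (Fin n) ℝ).1 * D),
    ⟨_, hD.symplectic_mul (g⁻¹).2, fun s _ => rfl⟩, ?_⟩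
  simp only
  rw [← Matrix.mul_assoc, h, Matrix.one_mul]

end Family

/-! ### The main theorem. -/

theorem theoremT (n : ℕ) (a b : ℝ) (hab : a < b)
    (Φ : ℝ → Matrix (Fin n ⊕ Fin n) (Fin n ⊕ Fin n) ℝ)
    (hΦc : ContinuousOn Φ (Icc a b))
    (hΦs : ∀ s ∈ Icc a b, Φ s ∈ Matrix.symplecticGroup (Fin n) ℝ)
    (Ya Yb : ℝ → Matrix (Fin n ⊕ Fin n) (Fin n) ℝ)
    (hYa : Ya ∈ lagrangianFamily a b Φ) (hYa_ini : Ya a = vertE n)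
    (hYb : Yb ∈ lagrangianFamily a b Φ) (hYb_ini : Yb b = vertE n) :
    -- the oscillation numbers of the members of the family are well defined
    (∀ Y ∈ lagrangianFamily a b Φ,
      IsOscNumber a b Y (oscNumber a b Y) ∧ IsDualOscNumber a b Y (dualOscNumber a b Y)) ∧
    ∀ l r : ℤ,
      oscNumber a b Ya ≤ l → l ≤ oscNumber a b Yb →
      dualOscNumber a b Yb ≤ r → r ≤ dualOscNumber a b Ya →
      (∃ Y ∈ lagrangianFamily a b Φ, oscNumber a b Y = l ∧ dualOscNumber a b Y = r) ∧
      (r ≤ l → ∃ Y ∈ lagrangianFamily a b Φ, oscNumber a b Y = l ∧ dualOscNumber a b Y = r ∧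
        (Y a).toRows₁ = 1) ∧
      (l ≤ r → ∃ Y ∈ lagrangianFamily a b Φ, oscNumber a b Y = l ∧ dualOscNumber a b Y = r ∧
        (Y b).toRows₁ = 1) ∧
      (l = r → ∃ Y ∈ lagrangianFamily a b Φ, oscNumber a b Y = l ∧ dualOscNumber a b Y = r ∧
        IsUnit (Y a).toRows₁ ∧ IsUnit (Y b).toRows₁) := by
  have hc := fun Y hY => continuousOn_of_mem_lagrangianFamily (Y := Y) hΦc hY
  have hL := fun Y hY => isLagrangianPlane_of_mem_lagrangianFamily (Y := Y) hΦs hY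
  refine ⟨fun Y hY => ⟨isOscNumber_oscNumber hab (hc Y hY) (hL Y hY),
    isDualOscNumber_dualOscNumber hab (hc Y hY) (hL Y hY)⟩, fun l r hl hl' hr hr' => ?_⟩
  have ha : a ∈ Icc a b := left_mem_Icc.2 hab.le
  have hb : b ∈ Icc a b := right_mem_Icc.2 hab.le
  have hw := fun Y A hY hA => wronskian_eq_of_mem_lagrangianFamily (Y := Y) (A := A) hΦs hY hA
  have hsub : ∀ Y ∈ lagrangianFamily a b Φ, ∀ A ∈ lagrangianFamily a b Φ,
      oscNumber a b Y - oscNumber a b A = (compIndex (Y b) (A b) : ℤ) - compIndex (Y a) (A a) :=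
    fun Y hY A hA => oscNumber_sub_oscNumber hab (hc Y hY) (hc A hA) (hL Y hY) (hL A hA)
      fun s hs x hx => by rw [hw Y A hY hA s hs x hx]
  have hdual := fun Y hY => dualOscNumber_eq hab (hc Y hY) (hL Y hY)
  have hE : (vertE n).toRows₁.rank = 0 := by simp [vertE]
  have hda := hdual Ya hYa
  have hdb := hdual Yb hYb
  rw [hYa_ini, hE] at hda
  rw [hYb_ini, hE] at hdb
  -- prescribing the value at the right endpoint, for `l ≤ r`
  have hright : l ≤ r → ∃ Y ∈ lagrangianFamily a b Φ, oscNumber a b Y = l ∧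
      dualOscNumber a b Y = r ∧ (Y b).toRows₁ = 1 ∧
      (l = r → IsUnit (Y a).toRows₁ ∧ IsUnit (Y b).toRows₁) := by
    intro hlr
    -- Since `N*(Y_a) = N(Y_a) + rank X_a(b)`, here `k + m = rank X_a(b) + l - r`, admissible
    -- exactly because `l ≤ r`.
    obtain ⟨Q, hQ, hk, hm⟩ := exists_compIndex_eq (hL Ya hYa b hb)
      (k := (l - oscNumber a b Ya).toNat) (m := (dualOscNumber a b Ya - r).toNat) (by omega)
    have hQL := isLagrangianPlane_fromRows_one hQ
    obtain ⟨Y, hY, hYb'⟩ := exists_mem_lagrangianFamily hΦs hb hQL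
    have h1 := hsub Y hY Ya hYa
    have h2 := hdual Y hY
    have h3 := compIndex_add_dualCompIndex hQL (hL Ya hYa b hb)
    -- The constant Wronskian carries the rank from `b` to `a`. With `h3` it yields `rank X(a) = n +
    -- l - r`, hence `N*(Y) = r`, and invertibility of `X(a)` when `l = r`.
    have h4 : (wronskian (Y b) (Ya b)).rank = (Y a).toRows₁.rank := by
      rw [hw Y Ya hY hYa b hb a ha, hYa_ini, rank_wronskian_vertE]
    rw [hYa_ini, compIndex_vertE (hL Y hY a ha), hYb', hk] at h1
    rw [hYb', toRows₁_fromRows, rank_one, Fintype.card_fin] at h2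
    rw [hYb'] at h4
    rw [hk, hm, h4, toRows₁_fromRows, rank_one, Fintype.card_fin] at h3
    refine ⟨Y, hY, by omega, by omega, by rw [hYb', toRows₁_fromRows], fun hlr' => ⟨?_, ?_⟩⟩
    · exact isUnit_of_rank_eq _ (by omega)
    · rw [hYb', toRows₁_fromRows]
      exact isUnit_one
  -- prescribing the value at the left endpoint, for `r ≤ l`
  have hleft : r ≤ l → ∃ Y ∈ lagrangianFamily a b Φ, oscNumber a b Y = l ∧
      dualOscNumber a b Y = r ∧ (Y a).toRows₁ = 1 := by
    intro hlr
    -- Here `N*(Y_b) = N(Y_b) - rank X_b(a)`, so `k + m = rank X_b(a) + r - l`; the increment of `μ`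
    -- now comes from the left endpoint with a minus sign.
    obtain ⟨Q, hQ, hk, hm⟩ := exists_compIndex_eq (hL Yb hYb a ha)
      (k := (oscNumber a b Yb - l).toNat) (m := (r - dualOscNumber a b Yb).toNat) (by omega)
    have hQL := isLagrangianPlane_fromRows_one hQ
    obtain ⟨Y, hY, hYa'⟩ := exists_mem_lagrangianFamily hΦs ha hQL
    have h1 := hsub Y hY Yb hYb
    have h2 := hdual Y hY
    have h3 := compIndex_add_dualCompIndex hQL (hL Yb hYb a ha)
    have h4 : (wronskian (Y a) (Yb a)).rank = (Y b).toRows₁.rank := by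
      rw [hw Y Yb hY hYb a ha b hb, hYb_ini, rank_wronskian_vertE]
    rw [hYb_ini, compIndex_vertE (hL Y hY b hb), hYa', hk] at h1
    rw [hYa', toRows₁_fromRows, rank_one, Fintype.card_fin] at h2
    rw [hYa'] at h4
    rw [hk, hm, h4, toRows₁_fromRows, rank_one, Fintype.card_fin] at h3
    exact ⟨Y, hY, by omega, by omega, by rw [hYa', toRows₁_fromRows]⟩
  refine ⟨?_, hleft, fun h => ?_, fun h => ?_⟩
  · rcases le_total l r with h | h
    · obtain ⟨Y, hY, e1, e2, -⟩ := hright h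
      exact ⟨Y, hY, e1, e2⟩
    · obtain ⟨Y, hY, e1, e2, -⟩ := hleft h
      exact ⟨Y, hY, e1, e2⟩
  · obtain ⟨Y, hY, e1, e2, e3, -⟩ := hright h
    exact ⟨Y, hY, e1, e2, e3⟩
  · obtain ⟨Y, hY, e1, e2, -, e3⟩ := hright h.le
    exact ⟨Y, hY, e1, e2, e3 h⟩
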